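/- Let $K$ be a number field. An order of $K$ is a subring that is a full-rank $\mathbb{Z}$-lattice in $K$. A level datum $(\mathcal{O};\mathfrak{m},\Sigma)$ for $K$ consists of an order $\mathcal{O}$ of $K$, an ideal $\mathfrak{m}$ of $\mathcal{O}$ and a set $\Sigma$ of embeddings $K\hookrightarrow\mathbb{R}$. We write $(\mathcal{O};\mathfrak{m},\Sigma)\le(\mathcal{O}';\mathfrak{m}',\Sigma')$ if $\mathcal{O}\subseteq\mathcal{O}'$, $\mathfrak{m}\mathcal{O}'\subseteq\mathfrak{m}'$ and $\Sigma\supseteq\Sigma'$. For subsets $A,B$ of $K$ put $(A:B)=\{x\in K: xB\subseteq A\}$. For an ideal $I$ of a commutative ring $R$ let $\mathrm{U}_I(R)=\{u\in R^\times: u\equiv 1 \bmod I\}$. For an order $\mathcal{O}$ let $\mathrm{U}_{\mathfrak{m},\Sigma}(\mathcal{O})=\{u\in \mathrm{U}_{\mathfrak{m}}(\mathcal{O}): \rho(u)>0 \text{ for all } \rho\in\Sigma\}$, and for an ideal $\mathfrak{d}$ of $\mathcal{O}$ let $\mathrm{U}_{\mathfrak{m}}(\mathcal{O}/\mathfrak{d})$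 be $\mathrm{U}_I(\mathcal{O}/\mathfrak{d})$, where $I$ is the image of $\mathfrak{m}$ in $\mathcal{O}/\mathfrak{d}$. A fractional $\mathcal{O}$-ideal is coprime to $\mathfrak{m}$ if it equals $(\mathfrak{a}:\mathfrak{b})$ for ideals $\mathfrak{a},\mathfrak{b}$ of $\mathcal{O}$ with $\mathfrak{a}+\mathfrak{m}=\mathfrak{b}+\mathfrak{m}=\mathcal{O}$ and $\mathfrak{b}$ invertible. For $\alpha,\beta\in K$ write $\alpha\equiv\beta \bmod \mathfrak{m}$ if $\alpha=\alpha_1/\alpha_2$ and $\beta=\beta_1/\beta_2$ with $\alpha_i,\beta_i\in\mathcal{O}$, $\alpha_2,\beta_2\ne 0$, $\alpha_2\mathcal{O}+\mathfrak{m}=\beta_2\mathcal{O}+\mathfrak{m}=\mathcal{O}$ and $\alpha_1\beta_2-\alpha_2\beta_1\in\mathfrak{m}$. The ray class group is $$\mathrm{Cl}_{\mathfrak{m},\Sigma}(\mathcal{O})=\frac{\{\text{invertible fractional ideals of }\mathcal{O}\text{ coprime to }\mathfrak{m}\}}{\{\alpha\mathcal{O}:\alpha\in K^\times,\ \alpha\equiv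 1 \bmod \mathfrak{m},\ \rho(\alpha)>0\text{ for all }\rho\in\Sigma\}}.$$ **Theorem.** Let $(\mathcal{O};\mathfrak{m},\Sigma)\le(\mathcal{O}';\mathfrak{m}',\Sigma')$ be level data for $K$, and let $\mathfrak{d}$ be a nonzero ideal of $\mathcal{O}'$ with $\mathfrak{d}\subseteq(\mathfrak{m}:\mathcal{O}')$ (so that $\mathfrak{d}$ is also an ideal of $\mathcal{O}$). Then there is an exact sequence of groups $$1\to\frac{\mathrm{U}_{\mathfrak{m}',\Sigma'}(\mathcal{O}')}{\mathrm{U}_{\mathfrak{m},\Sigma}(\mathcal{O})}\xrightarrow{\,f\,}\frac{\mathrm{U}_{\mathfrak{m}'}(\mathcal{O}'/\mathfrak{d})}{\mathrm{U}_{\mathfrak{m}}(\mathcal{O}/\mathfrak{d})}\times\{\pm1\}^{\Sigma\setminus\Sigma'}\xrightarrow{\,g\,}\mathrm{Cl}_{\mathfrak{m},\Sigma}(\mathcal{O})\xrightarrow{\,e\,}\mathrm{Cl}_{\mathfrak{m}',\Sigma'}(\mathcal{O}')\to1,$$ in which - $f([u])=\big([u \bmod \mathfrak{d}],(\operatorname{sgn}\rho(u))_{\rho\in\Sigma\setminus\Sigma'}\big)$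 for $u\in \mathrm{U}_{\mathfrak{m}',\Sigma'}(\mathcal{O}')$; - $g\big([\alpha \bmod \mathfrak{d}],(\operatorname{sgn}\rho(\alpha))_{\rho\in\Sigma\setminus\Sigma'}\big)=[\alpha\mathcal{O}'\cap\mathcal{O}]$ for every nonzero $\alpha\in\mathcal{O}'$ such that $\alpha \bmod \mathfrak{d}$ lies in $\mathrm{U}_{\mathfrak{m}'}(\mathcal{O}'/\mathfrak{d})$ and $\rho(\alpha)>0$ for all $\rho\in\Sigma'$; - $e([\mathfrak{a}])=[\mathfrak{a}\mathcal{O}']$ for every invertible fractional ideal $\mathfrak{a}$ of $\mathcal{O}$ coprime to $\mathfrak{m}$. -/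

import Mathlib

open scoped nonZeroDivisors

namespace RayClass

section Units

variable {R : Type*} [CommRing R]

/-- `U_I(R)`: the units of `R` that are congruent to `1` modulo the ideal `I`. -/
def unitsMod (I : Ideal R) : Subgroup Rˣ where
  carrier := {u | (u : R) - 1 ∈ I}
  one_mem' := by simp
  mul_mem' := by
    intro a b ha hb
    have h : ((a * b : Rˣ) : R) - 1 = (a : R) * ((b : R) - 1) + ((a : R) - 1) := by
      push_cast
      ring
    change ((a * b : Rˣ) : R) - 1 ∈ I
    rw [h]
    exact I.add_mem (I.mul_mem_left _ hb) ha
  inv_mem' := by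
    intro a ha
    have h : ((a⁻¹ : Rˣ) : R) - 1 = -((a⁻¹ : Rˣ) : R) * ((a : R) - 1) := by
      have := a.inv_mul
      linear_combination this
    change ((a⁻¹ : Rˣ) : R) - 1 ∈ I
    rw [h]
    exact I.mul_mem_left _ ha

theorem mem_unitsMod {I : Ideal R} {u : Rˣ} : u ∈ unitsMod I ↔ (u : R) - 1 ∈ I := Iff.rfl

/-- `U_m(R/d)`, for ideals `m` and `d` of `R`: the units of `R/d` that are congruent to `1` modulo
the ideal generated by the image of `m`. -/
abbrev residueUnits (m d : Ideal R) : Subgroup (R ⧸ d)ˣ :=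
  unitsMod (m.map (Ideal.Quotient.mk d))

variable {R' : Type*} [CommRing R']

/-- The map `U_m(R/d) → U_{m'}(R'/d)` induced by a ring homomorphism `φ : R → R'` with
`φ(m) ⊆ m'`; here `R/d` stands for `R` modulo the contraction of the ideal `d` of `R'`. -/
def residueMap (φ : R →+* R') {m : Ideal R} {m' : Ideal R'} (hm : m.map φ ≤ m') (d : Ideal R') :
    residueUnits m (d.comap φ) →* residueUnits m' d :=
  ((Units.map (Ideal.quotientMap d φ le_rfl : R ⧸ d.comap φ →* R' ⧸ d)).comp
    (residueUnits m (d.comap φ)).subtype).codRestrict _ (by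
      rintro ⟨u, hu⟩
      have h1 := Ideal.mem_map_of_mem (Ideal.quotientMap d φ le_rfl) (mem_unitsMod.1 hu)
      rw [Ideal.map_map, Ideal.quotientMap_comp_mk, ← Ideal.map_map] at h1
      have h2 := Ideal.map_mono hm h1
      rw [map_sub, map_one] at h2
      exact h2)

/-- `U_{m'}(R'/d) / U_m(R/d)`. -/
abbrev ResidueIndex (φ : R →+* R') {m : Ideal R} {m' : Ideal R'} (hm : m.map φ ≤ m')
    (d : Ideal R') : Type _ :=
  residueUnits m' d ⧸ (residueMap φ hm d).range

end Units

variable {K : Type*} [Field K]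

/-- A shortcut instance, by which ideals of a subring `O` of `K`, and the quotients by them, are
formed with the ring structure of `O` itself. -/
instance (O : Subring K) : CommSemiring O := CommRing.toCommSemiring

/-- `U_{I,Σ}(O)` for a subring `O` of `K`: the units of `O` that are congruent to `1` modulo `I`
and positive under every real embedding of `K` that belongs to `S`. -/
def unitsModPos {O : Subring K} (I : Ideal O) (S : Set (K →+* ℝ)) : Subgroup Oˣ where
  carrier := {u | u ∈ unitsMod I ∧ ∀ ρ ∈ S, 0 < ρ ((u : O) : K)}
  one_mem' := ⟨one_mem _, fun ρ _ => by simp⟩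
  mul_mem' := by
    rintro a b ⟨ha, ha'⟩ ⟨hb, hb'⟩
    refine ⟨mul_mem ha hb, fun ρ hρ => ?_⟩
    simpa using mul_pos (ha' ρ hρ) (hb' ρ hρ)
  inv_mem' := by
    rintro a ⟨ha, ha'⟩
    refine ⟨inv_mem ha, fun ρ hρ => ?_⟩
    have h : ρ ((a : O) : K) * ρ (((a⁻¹ : Oˣ) : O) : K) = 1 := by
      rw [← map_mul, ← Subring.coe_mul, Units.mul_inv]
      simp
    exact (pos_iff_pos_of_mul_pos (h ▸ one_pos)).1 (ha' ρ hρ)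

/-- The colon `(A : B) = {x ∈ K : x B ⊆ A}`. -/
def colon (A B : Set K) : Set K := {x | ∀ y ∈ B, x * y ∈ A}

/-- The set of elements of `K` that lie in the ideal `I` of the subring `O`. -/
def idealSet {O : Subring K} (I : Ideal O) : Set K := Subtype.val '' (I : Set O)

section Congruence

variable {O : Subring K}

/-- `α ≡ β (mod m)` for elements of `K`. -/
def ModCong (m : Ideal O) (α β : K) : Prop :=
  ∃ a₁ a₂ b₁ b₂ : O, a₂ ≠ 0 ∧ b₂ ≠ 0 ∧ Ideal.span {a₂} ⊔ m = ⊤ ∧ Ideal.span {b₂} ⊔ m = ⊤ ∧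
    α = (a₁ : K) / a₂ ∧ β = (b₁ : K) / b₂ ∧ a₁ * b₂ - a₂ * b₁ ∈ m

theorem sup_mul_eq_top {a b m : Ideal O} (ha : a ⊔ m = ⊤) (hb : b ⊔ m = ⊤) : a * b ⊔ m = ⊤ := by
  rw [← Ideal.isCoprime_iff_sup_eq] at *
  exact ha.mul_left hb

theorem modCong_one_iff {m : Ideal O} {α : K} :
    ModCong m α 1 ↔ ∃ a b : O, b ≠ 0 ∧ Ideal.span {b} ⊔ m = ⊤ ∧ α = (a : K) / b ∧
      a - b ∈ m := by
  constructor
  · rintro ⟨a, b, c, d, hb, hd, hbm, hdm, h1, h2, h3⟩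
    refine ⟨a, b, hb, hbm, h1, ?_⟩
    have hd' : (d : K) ≠ 0 := by simpa using hd
    have hcd : c = d := by
      apply Subtype.ext
      rw [eq_div_iff hd', one_mul] at h2
      exact h2.symm
    subst hcd
    have h4 : c * (a - b) ∈ m := by
      have : c * (a - b) = a * c - b * c := by ring
      rwa [this]
    obtain ⟨x, hx, y, hy, hxy⟩ := Submodule.mem_sup.1 ((Ideal.eq_top_iff_one _).1 hdm)
    obtain ⟨z, rfl⟩ := Ideal.mem_span_singleton'.1 hx
    have h5 : a - b = z * (c * (a - b)) + (a - b) * y := by linear_combination (b - a) * hxy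
    rw [h5]
    exact m.add_mem (m.mul_mem_left _ h4) (m.mul_mem_left _ hy)
  · rintro ⟨a, b, hb, hbm, h1, h2⟩
    exact ⟨a, b, 1, 1, hb, one_ne_zero, hbm, by simp, h1, by simp, by simpa using h2⟩

theorem span_sup_eq_top_of_sub_mem {m : Ideal O} {a b : O} (hb : Ideal.span {b} ⊔ m = ⊤)
    (h : a - b ∈ m) : Ideal.span {a} ⊔ m = ⊤ := by
  rw [Ideal.eq_top_iff_one] at hb ⊢
  obtain ⟨x, hx, y, hy, hxy⟩ := Submodule.mem_sup.1 hb
  obtain ⟨z, rfl⟩ := Ideal.mem_span_singleton'.1 hx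
  refine Submodule.mem_sup.2 ⟨z * a, Ideal.mem_span_singleton'.2 ⟨z, rfl⟩, y - z * (a - b),
    m.sub_mem hy (m.mul_mem_left _ h), ?_⟩
  linear_combination hxy

/-- The elements `α ∈ Kˣ` with `α ≡ 1 (mod m)` and `ρ(α) > 0` for all `ρ ∈ S`. -/
def rayElements (m : Ideal O) (S : Set (K →+* ℝ)) : Subgroup Kˣ where
  carrier := {α | ModCong m α 1 ∧ ∀ ρ ∈ S, 0 < ρ (α : K)}
  one_mem' := ⟨modCong_one_iff.2 ⟨1, 1, one_ne_zero, by simp, by simp, by simp⟩, by simp⟩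
  mul_mem' := by
    rintro α β ⟨h, h'⟩ ⟨k, k'⟩
    refine ⟨?_, fun ρ hρ => by simpa using mul_pos (h' ρ hρ) (k' ρ hρ)⟩
    obtain ⟨a, b, hb, hbm, h1, h2⟩ := modCong_one_iff.1 h
    obtain ⟨c, d, hd, hdm, k1, k2⟩ := modCong_one_iff.1 k
    refine modCong_one_iff.2 ⟨a * c, b * d, mul_ne_zero hb hd, ?_, ?_, ?_⟩
    · rw [← Ideal.span_singleton_mul_span_singleton]
      exact sup_mul_eq_top hbm hdm
    · push_cast
      rw [h1, k1, div_mul_div_comm]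
    · have : a * c - b * d = a * (c - d) + d * (a - b) := by ring
      rw [this]
      exact m.add_mem (m.mul_mem_left _ k2) (m.mul_mem_left _ h2)
  inv_mem' := by
    rintro α ⟨h, h'⟩
    refine ⟨?_, fun ρ hρ => by simpa using h' ρ hρ⟩
    obtain ⟨a, b, hb, hbm, h1, h2⟩ := modCong_one_iff.1 h
    refine modCong_one_iff.2 ⟨b, a, ?_, span_sup_eq_top_of_sub_mem hbm h2, ?_, ?_⟩
    · rintro rfl
      exact α.ne_zero (by simp at h1)
    · rw [Units.val_inv_eq_inv_val, h1, inv_div]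
    · rw [← neg_sub]
      exact m.neg_mem h2

end Congruence

section Fractional

variable {O : Subring K} [IsFractionRing O K]

/-- A fractional `O`-ideal is coprime to the integral ideal `m` if it is a quotient `(a : b)` of
integral ideals `a`, `b` coprime to `m`, with `b` invertible. -/
def IsCoprimeTo (m : Ideal O) (c : FractionalIdeal O⁰ K) : Prop :=
  ∃ a b : Ideal O, a ⊔ m = ⊤ ∧ b ⊔ m = ⊤ ∧ IsUnit (b : FractionalIdeal O⁰ K) ∧
    (c : Set K) = colon (idealSet a) (idealSet b)

theorem colon_idealSet {a b : Ideal O} (hb : IsUnit (b : FractionalIdeal O⁰ K))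
    (c : FractionalIdeal O⁰ K) :
    (c : Set K) = colon (idealSet a) (idealSet b) ↔ c * b = a := by
  have hb0 : (b : FractionalIdeal O⁰ K) ≠ 0 := hb.ne_zero
  have hc : colon (idealSet a) (idealSet b)
      = ((a / b : FractionalIdeal O⁰ K) : Set K) := by
    ext x
    rw [SetLike.mem_coe, FractionalIdeal.mem_div_iff_of_ne_zero hb0]
    constructor
    · intro hx y hy
      obtain ⟨y', hy', rfl⟩ := (FractionalIdeal.mem_coeIdeal _).1 hy
      obtain ⟨z, hz, hz'⟩ := hx y' ⟨y', hy', rfl⟩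
      exact (FractionalIdeal.mem_coeIdeal _).2 ⟨z, hz, hz'⟩
    · rintro hx _ ⟨y, hy, rfl⟩
      obtain ⟨z, hz, hz'⟩ := (FractionalIdeal.mem_coeIdeal _).1
        (hx y ((FractionalIdeal.mem_coeIdeal _).2 ⟨y, hy, rfl⟩))
      exact ⟨z, hz, hz'⟩
  have hdiv : (a / b : FractionalIdeal O⁰ K) * b = a := by
    apply le_antisymm
    · exact (FractionalIdeal.le_div_iff_mul_le hb0).1 le_rfl
    · obtain ⟨u, hu⟩ := hb
      rw [← hu]
      have : (a : FractionalIdeal O⁰ K) * (↑u⁻¹ : FractionalIdeal O⁰ K) ≤ a / u := by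
        rw [FractionalIdeal.le_div_iff_mul_le (hu ▸ hb0), mul_assoc, Units.inv_mul, mul_one]
      calc (a : FractionalIdeal O⁰ K) = a * (↑u⁻¹ : FractionalIdeal O⁰ K) * u := by
            rw [mul_assoc, Units.inv_mul, mul_one]
        _ ≤ _ := by gcongr
  rw [hc, SetLike.coe_set_eq]
  constructor
  · rintro rfl
    exact hdiv
  · intro h
    exact hb.mul_right_cancel (h.trans hdiv.symm)

theorem isCoprimeTo_iff {m : Ideal O} {c : FractionalIdeal O⁰ K} :
    IsCoprimeTo m c ↔ ∃ a b : Ideal O, a ⊔ m = ⊤ ∧ b ⊔ m = ⊤ ∧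
      IsUnit (b : FractionalIdeal O⁰ K) ∧ c * b = a := by
  constructor
  · rintro ⟨a, b, h1, h2, h3, h4⟩
    exact ⟨a, b, h1, h2, h3, (colon_idealSet h3 c).1 h4⟩
  · rintro ⟨a, b, h1, h2, h3, h4⟩
    exact ⟨a, b, h1, h2, h3, (colon_idealSet h3 c).2 h4⟩

/-- `J*_m(O)`: the group of invertible fractional `O`-ideals coprime to `m`. -/
def coprimeIdeals (m : Ideal O) : Subgroup (FractionalIdeal O⁰ K)ˣ where
  carrier := {c | IsCoprimeTo m (c : FractionalIdeal O⁰ K)}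
  one_mem' := isCoprimeTo_iff.2 ⟨⊤, ⊤, by simp, by simp, by simp, by simp⟩
  mul_mem' := by
    intro c₁ c₂ h₁ h₂
    obtain ⟨a₁, b₁, h1, h2, h3, h4⟩ := isCoprimeTo_iff.1 h₁
    obtain ⟨a₂, b₂, k1, k2, k3, k4⟩ := isCoprimeTo_iff.1 h₂
    refine isCoprimeTo_iff.2 ⟨a₁ * a₂, b₁ * b₂, sup_mul_eq_top h1 k1, sup_mul_eq_top h2 k2, ?_, ?_⟩
    · rw [FractionalIdeal.coeIdeal_mul]
      exact h3.mul k3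
    · rw [FractionalIdeal.coeIdeal_mul, FractionalIdeal.coeIdeal_mul, ← h4, ← k4, Units.val_mul]
      exact mul_mul_mul_comm _ _ _ _
  inv_mem' := by
    intro c h
    obtain ⟨a, b, h1, h2, h3, h4⟩ := isCoprimeTo_iff.1 h
    refine isCoprimeTo_iff.2 ⟨b, a, h2, h1, ?_, ?_⟩
    · rw [← h4]
      exact c.isUnit.mul h3
    · rw [← h4, Units.inv_mul_cancel_left]

/-- `P_{m,Σ}(O)`: the group of the principal ideals `αO`, where `α ∈ Kˣ`, `α ≡ 1 (mod m)` and
`ρ(α) > 0` for all `ρ ∈ S`. -/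
noncomputable def rayIdeals (m : Ideal O) (S : Set (K →+* ℝ)) :
    Subgroup (FractionalIdeal O⁰ K)ˣ :=
  (rayElements m S).map (toPrincipalIdeal O K)

/-- `P_{m,Σ}(O)` is contained in `J*_m(O)`, so that the quotient below makes sense. -/
theorem rayIdeals_le (m : Ideal O) (S : Set (K →+* ℝ)) : rayIdeals m S ≤ coprimeIdeals m := by
  rintro _ ⟨α, ⟨h, -⟩, rfl⟩
  obtain ⟨a, b, hb, hbm, h1, h2⟩ := modCong_one_iff.1 h
  have hb' : (b : K) ≠ 0 := by simpa using hb
  refine isCoprimeTo_iff.2 ⟨Ideal.span {a}, Ideal.span {b}, span_sup_eq_top_of_sub_mem hbm h2,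
    hbm, ?_, ?_⟩
  · rw [FractionalIdeal.coeIdeal_span_singleton]
    exact ⟨toPrincipalIdeal O K (Units.mk0 (b : K) hb'), by simp; rfl⟩
  · rw [FractionalIdeal.coeIdeal_span_singleton, FractionalIdeal.coeIdeal_span_singleton,
      coe_toPrincipalIdeal, FractionalIdeal.spanSingleton_mul_spanSingleton, h1]
    congr 1
    exact div_mul_cancel₀ _ hb'

/-- `Cl_{m,Σ}(O) = J*_m(O) / P_{m,Σ}(O)`: the ray class group of `O` modulo `(m, Σ)`. -/
abbrev RayClassGroup (m : Ideal O) (S : Set (K →+* ℝ)) : Type _ :=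
  coprimeIdeals m ⧸ (rayIdeals m S).subgroupOf (coprimeIdeals m)

end Fractional

/-- An order of the number field `K`: a subring that is a full rank `ℤ`-lattice in `K`. -/
structure IsOrder [NumberField K] (O : Subring K) : Prop where
  finite : Module.Finite ℤ O
  span_eq_top : Submodule.span ℚ (O : Set K) = ⊤

theorem IsOrder.isFractionRing [NumberField K] {O : Subring K} (h : IsOrder O) :
    IsFractionRing O K := by
  have key : ∀ x : K, ∃ n : ℕ, n ≠ 0 ∧ (n : K) * x ∈ O := by
    intro x
    have hx : x ∈ Submodule.span ℚ (O : Set K) := by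
      rw [h.span_eq_top]
      trivial
    induction hx using Submodule.span_induction with
    | mem x hx => exact ⟨1, one_ne_zero, by simpa using hx⟩
    | zero => exact ⟨1, one_ne_zero, by simp⟩
    | add x y _ _ hx hy =>
      obtain ⟨n, hn, hx⟩ := hx
      obtain ⟨k, hk, hy⟩ := hy
      refine ⟨n * k, mul_ne_zero hn hk, ?_⟩
      have e : ((n * k : ℕ) : K) * (x + y) = (k : K) * (n * x) + (n : K) * (k * y) := by
        push_cast
        ring
      rw [e]
      exact O.add_mem (O.mul_mem (natCast_mem O k) hx) (O.mul_mem (natCast_mem O n) hy)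
    | smul q x _ hx =>
      obtain ⟨n, hn, hx⟩ := hx
      refine ⟨n * q.den, mul_ne_zero hn q.den_nz, ?_⟩
      have hq : (q.den : K) ≠ 0 := by exact_mod_cast q.den_nz
      have e : ((n * q.den : ℕ) : K) * (q • x) = (q.num : K) * (n * x) := by
        rw [Rat.smul_def, Rat.cast_def]
        push_cast
        field_simp
      rw [e]
      exact O.mul_mem (intCast_mem O q.num) hx
  refine IsFractionRing.of_field O K fun x => ?_
  obtain ⟨n, hn, hx⟩ := key x
  refine ⟨⟨_, hx⟩, (n : O), ?_⟩
  have hn' : (n : K) ≠ 0 := by exact_mod_cast hn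
  change x = (n : K) * x / ((n : O) : K)
  rw [Subring.coe_natCast]
  field_simp

/-- A level datum `(O; m, Σ)` for `K`: an order `O`, an integral `O`-ideal `m` and a set `Σ` of
real embeddings of `K`. -/
structure LevelDatum (K : Type*) [Field K] [NumberField K] where
  order : Subring K
  isOrder : IsOrder order
  modulus : Ideal order
  places : Set (K →+* ℝ)

namespace LevelDatum

variable [NumberField K]

instance (D : LevelDatum K) : IsFractionRing D.order K := D.isOrder.isFractionRing

/-- The partial order on level data: `O ⊆ O'`, `m O' ⊆ m'` and `Σ ⊇ Σ'`. -/
structure Le (D D' : LevelDatum K) : Prop where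
  order_le : D.order ≤ D'.order
  modulus_le : D.modulus.map (Subring.inclusion order_le) ≤ D'.modulus
  places_le : D'.places ⊆ D.places

/-- The ray class group `Cl_{m,Σ}(O)` of a level datum. -/
abbrev Cl (D : LevelDatum K) : Type _ := RayClassGroup D.modulus D.places

variable {D D' : LevelDatum K}

/-- The inclusion `U_{m,Σ}(O) → U_{m',Σ'}(O')`. -/
def unitsInclusion (h : Le D D') :
    unitsModPos D.modulus D.places →* unitsModPos D'.modulus D'.places :=
  ((Units.map (Subring.inclusion h.order_le : D.order →* D'.order)).comp
    (unitsModPos D.modulus D.places).subtype).codRestrict _ (by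
      rintro ⟨u, hu, hu'⟩
      refine ⟨?_, fun ρ hρ => hu' ρ (h.places_le hρ)⟩
      have := h.modulus_le (Ideal.mem_map_of_mem (Subring.inclusion h.order_le) hu)
      rw [map_sub, map_one] at this
      exact this)

/-- `U_{m',Σ'}(O') / U_{m,Σ}(O)`. -/
abbrev UnitIndex (h : Le D D') : Type _ :=
  unitsModPos D'.modulus D'.places ⧸ (unitsInclusion h).range

/-- `U_{m'}(O'/d) / U_m(O/d)`, where `d` is an ideal of `O'`. If `d` is contained in `O`, then its
contraction to `O` is the set `d` itself, regarded as an `O`-ideal. -/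
abbrev LocalIndex (h : Le D D') (d : Ideal D'.order) : Type _ :=
  ResidueIndex (Subring.inclusion h.order_le) h.modulus_le d

end LevelDatum

/-- The signs of `x` under the real embeddings in `S`, as elements of `{±1}` (for `x ≠ 0`). -/
noncomputable def signs (S : Set (K →+* ℝ)) (x : K) : S → ℤˣ :=
  fun ρ => if 0 < ρ.1 x then 1 else -1

end RayClass

/-! Ideals coprime to `d` do not see the difference between `O` and `O'`. As `d` is an ideal of `O'`
lying inside `O`, the maps `a ↦ aO'` and `A ↦ A ∩ O` are mutually inverse on them
(`comap_map_eq_of_sup_eq_top`, `map_comap_eq_of_sup_eq_top`), respect products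
(`comap_mul_of_sup_eq_top`) and preserve invertibility (`comap_mem_integralIdeals`). A moving lemma,
`exists_integralClass_eq`, puts an invertible integral ideal coprime to `d` into every ray class.
Hence `e` is surjective, and a class in its kernel is that of `γO' ∩ O` with `γ ≡ 1` modulo `m'` and
`γ` positive on `Σ'`.

Such elements, taken nonzero and prime to `d`, form the monoid `congruenceElements`. It maps onto
the middle group, because residues and signs are independent (`localClass_surjective`), and to `Cl`
by `α ↦ [αO' ∩ O]`. If `α` is trivial in the middle group, then `α` lies in `O` and `αO' ∩ O = αO`
has trivial class; so the second map factors through the first, which yields `g`. Conversely, if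
`αO' ∩ O = wO` with `w` a ray element, extension to `O'` gives `α = wu` with `u` in `U_{m',Σ'}(O')`,
and `w` is trivial in the middle group: `α` has the image of `u` (`exists_localClass_units_eq`). A
unit `u` trivial in the middle group lies in `O` and is a unit there, so `f` is injective. -/

namespace RayClass

/-! ### Extension and contraction of ideals coprime to `d` -/

section Contraction

theorem exists_mem_one_sub_mem {R : Type*} [CommRing R] {a b : Ideal R} (h : a ⊔ b = ⊤) :
    ∃ x ∈ a, 1 - x ∈ b := by
  obtain ⟨x, hx, y, hy, hxy⟩ := Submodule.mem_sup.1 ((Ideal.eq_top_iff_one _).1 h)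
  exact ⟨x, hx, by rwa [← hxy, add_sub_cancel_left]⟩

theorem sup_eq_top_of_one_sub_mem {R : Type*} [CommRing R] {a b : Ideal R} {x : R} (hx : x ∈ a)
    (h : 1 - x ∈ b) : a ⊔ b = ⊤ :=
  (Ideal.eq_top_iff_one _).2 (Submodule.mem_sup.2 ⟨x, hx, 1 - x, h, add_sub_cancel _ _⟩)

theorem map_sup_eq_top {R R' : Type*} [CommRing R] [CommRing R'] (φ : R →+* R') {a m : Ideal R}
    {m' : Ideal R'} (h : a ⊔ m = ⊤) (hm : m.map φ ≤ m') : a.map φ ⊔ m' = ⊤ := by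
  rw [eq_top_iff, ← Ideal.map_top φ, ← h, Ideal.map_sup]
  exact sup_le_sup_left hm _

variable {R R' : Type*} [CommRing R] [CommRing R'] {φ : R →+* R'} {d : Ideal R'}

/-- An element of `A` congruent to `1` modulo `d` already comes from `R`, since both `1` and `d` do.
-/
theorem comap_sup_comap_eq_top (hd : ∀ x ∈ d, x ∈ φ.range) {A : Ideal R'} (h : A ⊔ d = ⊤) :
    A.comap φ ⊔ d.comap φ = ⊤ := by
  obtain ⟨x, hx, hx'⟩ := exists_mem_one_sub_mem h
  obtain ⟨y, hy⟩ := hd _ hx'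
  refine sup_eq_top_of_one_sub_mem (x := 1 - y) ?_ ?_
  · rwa [Ideal.mem_comap, map_sub, map_one, hy, sub_sub_cancel]
  · rwa [Ideal.mem_comap, sub_sub_cancel, hy]

theorem map_comap_eq_of_sup_eq_top (hd : ∀ x ∈ d, x ∈ φ.range) {A : Ideal R'} (h : A ⊔ d = ⊤) :
    (A.comap φ).map φ = A := by
  refine le_antisymm Ideal.map_comap_le fun x hx => ?_
  obtain ⟨a, ha, ha'⟩ := exists_mem_one_sub_mem h
  obtain ⟨b, hb⟩ := hd _ ha'
  obtain ⟨y, hy⟩ := hd _ (d.mul_mem_left x ha')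
  have h1 : a = φ (1 - b) := by rw [map_sub, map_one, hb, sub_sub_cancel]
  -- Split `x = xa + x(1 - a)`: here `a` lies in the contraction of `A`, and so does `x(1 - a)`,
  -- which is in both `A` and `d`.
  have h2 : x = x * φ (1 - b) + φ y := by rw [hy, ← h1]; ring
  rw [h2]
  refine Ideal.add_mem _ (Ideal.mul_mem_left _ _ (Ideal.mem_map_of_mem _ ?_))
    (Ideal.mem_map_of_mem _ ?_)
  · rwa [Ideal.mem_comap, ← h1]
  · rw [Ideal.mem_comap, hy]
    exact A.mul_mem_right _ hx

/-- In short `(aR')d ⊆ a`: the coefficients from `R'` are absorbed by `d`, which comes from `R`. -/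
theorem exists_mem_of_mem_map_mul (hd : ∀ x ∈ d, x ∈ φ.range) {a : Ideal R} {x : R'}
    (hx : x ∈ a.map φ) : ∀ y ∈ d, ∃ z ∈ a, φ z = x * y := by
  refine Submodule.span_induction (p := fun x _ => ∀ y ∈ d, ∃ z ∈ a, φ z = x * y)
    ?_ ?_ ?_ ?_ hx
  · rintro _ ⟨b, hb, rfl⟩ y hy
    obtain ⟨c, rfl⟩ := hd y hy
    exact ⟨b * c, a.mul_mem_right _ hb, map_mul _ _ _⟩
  · intro y _
    exact ⟨0, a.zero_mem, by simp⟩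
  · intro x₁ x₂ _ _ h₁ h₂ y hy
    obtain ⟨z₁, hz₁, e₁⟩ := h₁ y hy
    obtain ⟨z₂, hz₂, e₂⟩ := h₂ y hy
    exact ⟨z₁ + z₂, a.add_mem hz₁ hz₂, by rw [map_add, e₁, e₂, add_mul]⟩
  · intro r x _ h y hy
    obtain ⟨z, hz, e⟩ := h (r * y) (d.mul_mem_left _ hy)
    exact ⟨z, hz, by rw [e, smul_eq_mul]; ring⟩

/-- Write `x = xb + x(1 - b)` with `b ∈ a` and `1 - b` in `d`; the second term is in `(aR')d ⊆ a`.
-/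
theorem comap_map_eq_of_sup_eq_top (hφ : Function.Injective φ) (hd : ∀ x ∈ d, x ∈ φ.range)
    {a : Ideal R} (h : a ⊔ d.comap φ = ⊤) : (a.map φ).comap φ = a := by
  refine le_antisymm (fun x hx => ?_) Ideal.le_comap_map
  obtain ⟨b, hb, hb'⟩ := exists_mem_one_sub_mem h
  obtain ⟨z, hz, e⟩ := exists_mem_of_mem_map_mul hd hx _ hb'
  rw [← map_mul] at e
  have h1 : x = x * b + z := by rw [hφ e]; ring
  rw [h1]
  exact a.add_mem (a.mul_mem_left _ hb) hz

/-- Both sides are coprime to `d`, hence determined by their extensions, and extension is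
multiplicative. -/
theorem comap_mul_of_sup_eq_top (hφ : Function.Injective φ) (hd : ∀ x ∈ d, x ∈ φ.range)
    {A B : Ideal R'} (hA : A ⊔ d = ⊤) (hB : B ⊔ d = ⊤) :
    (A * B).comap φ = A.comap φ * B.comap φ := by
  have h : A.comap φ * B.comap φ ⊔ d.comap φ = ⊤ := by
    have h1 := comap_sup_comap_eq_top hd hA
    have h2 := comap_sup_comap_eq_top hd hB
    rw [← Ideal.isCoprime_iff_sup_eq] at *
    exact h1.mul_left h2
  rw [← comap_map_eq_of_sup_eq_top hφ hd h, Ideal.map_mul, map_comap_eq_of_sup_eq_top hd hA,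
    map_comap_eq_of_sup_eq_top hd hB]

end Contraction

/-! ### Invertible ideals and the moving lemma -/

section Invertible

variable {R K : Type*} [CommRing R] [Field K] [Algebra R K] [IsFractionRing R K]

theorem isUnit_coeIdeal_of_mul_eq_span [IsDomain R] {a b : Ideal R} {y : R} (hy : y ≠ 0)
    (h : a * b = Ideal.span {y}) : IsUnit (a : FractionalIdeal R⁰ K) := by
  have h1 : (a : FractionalIdeal R⁰ K) * b
      = FractionalIdeal.spanSingleton R⁰ (algebraMap R K y) := by
    rw [← FractionalIdeal.coeIdeal_mul, h, FractionalIdeal.coeIdeal_span_singleton]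
  refine isUnit_of_mul_isUnit_left (y := (b : FractionalIdeal R⁰ K)) ?_
  have hy' : algebraMap R K y ≠ 0 := by simpa using hy
  exact ⟨toPrincipalIdeal R K (Units.mk0 _ hy'), by rw [h1, coe_toPrincipalIdeal, Units.val_mk0]⟩

/-- To contain is to divide, for invertible `a`: the cofactor is `ya⁻¹`. -/
theorem exists_mul_eq_span {a : Ideal R} (ha : IsUnit (a : FractionalIdeal R⁰ K)) {y : R}
    (hy : y ∈ a) : ∃ b : Ideal R, a * b = Ideal.span {y} := by
  obtain ⟨u, hu⟩ := ha
  have h1 : FractionalIdeal.spanSingleton R⁰ (algebraMap R K y) * (↑u⁻¹ : FractionalIdeal R⁰ K)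
      ≤ 1 := by
    rw [← Units.mul_inv u]
    gcongr
    rw [FractionalIdeal.spanSingleton_le_iff_mem, hu]
    exact FractionalIdeal.mem_coeIdeal_of_mem _ hy
  obtain ⟨b, hb⟩ := FractionalIdeal.le_one_iff_exists_coeIdeal.1 h1
  refine ⟨b, FractionalIdeal.coeIdeal_injective (K := K) ?_⟩
  simp only
  rw [FractionalIdeal.coeIdeal_mul, hb, FractionalIdeal.coeIdeal_span_singleton, ← hu,
    mul_left_comm, Units.mul_inv, mul_one]

theorem mul_left_le_of_isUnit {a b c : Ideal R} (ha : IsUnit (a : FractionalIdeal R⁰ K))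
    (h : a * b ≤ a * c) : b ≤ c := by
  obtain ⟨u, hu⟩ := ha
  rw [← FractionalIdeal.coeIdeal_le_coeIdeal K] at h ⊢
  rw [FractionalIdeal.coeIdeal_mul, FractionalIdeal.coeIdeal_mul, ← hu] at h
  have := mul_le_mul_right h (↑u⁻¹ : FractionalIdeal R⁰ K)
  simpa [← mul_assoc] using this

/-- An invertible ideal `a` coprime to `m` has an element congruent to `1` modulo `m` that
generates `a` locally at finitely many given maximal ideals not containing `m`. -/
theorem exists_mem_notMem_mul {a m : Ideal R} (ha : IsUnit (a : FractionalIdeal R⁰ K))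
    (hm : a ⊔ m = ⊤) (T : Finset (Ideal R)) (hT : ∀ p ∈ T, p.IsMaximal ∧ ¬ m ≤ p) :
    ∃ x ∈ a, 1 - x ∈ m ∧ ∀ p ∈ T, x ∉ a * p := by
  classical
  induction T using Finset.induction_on with
  | empty =>
    obtain ⟨x, hx, hx'⟩ := exists_mem_one_sub_mem hm
    exact ⟨x, hx, hx', by simp⟩
  | insert q T hq ih =>
    obtain ⟨x, hx, hx', hxT⟩ := ih fun p hp => hT p (Finset.mem_insert_of_mem hp)
    by_cases hxq : x ∈ a * q
    swap
    · refine ⟨x, hx, hx', fun p hp => ?_⟩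
      rcases Finset.mem_insert.1 hp with rfl | hp
      exacts [hxq, hxT p hp]
    obtain ⟨hqm, hmq⟩ := hT q (Finset.mem_insert_self _ _)
    have h1 : ¬ a ≤ a * q := fun h => hqm.ne_top (top_le_iff.1
      (mul_left_le_of_isUnit (K := K) ha (by simpa using h)))
    obtain ⟨y, hy, hyq⟩ := SetLike.not_le_iff_exists.1 h1
    -- An `e` in this product but not in `q` changes `x` neither modulo `m` nor, after
    -- multiplication by `y`, modulo `a * p` for `p ∈ T`.
    have h2 : ¬ m * ∏ p ∈ T, p ≤ q := by
      rw [hqm.isPrime.mul_le, hqm.isPrime.prod_le]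
      rintro (h | ⟨p, hp, h⟩)
      · exact hmq h
      · have := (hT p (Finset.mem_insert_of_mem hp)).1.eq_of_le hqm.ne_top h
        exact hq (this ▸ hp)
    obtain ⟨e, he, heq⟩ := SetLike.not_le_iff_exists.1 h2
    have hem : e ∈ m := (Ideal.mul_le_left : m * ∏ p ∈ T, p ≤ m) he
    have heT (p) (hp : p ∈ T) : e ∈ p :=
      (Ideal.mul_le_right.trans (Ideal.prod_le_inf.trans (Finset.inf_le hp)) :
        m * ∏ p ∈ T, p ≤ p) he
    refine ⟨x + e * y, a.add_mem hx (a.mul_mem_left _ hy), ?_, fun p hp => ?_⟩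
    · rw [← sub_sub]
      exact m.sub_mem hx' (m.mul_mem_right _ hem)
    · rcases Finset.mem_insert.1 hp with rfl | hp
      · intro h
        have h3 := (Ideal.add_mem_iff_right _ hxq).1 h
        -- As `e` is invertible modulo `q`, having `e * y` in `a * q` would force `y` into `a * q`.
        obtain ⟨c, i, hi, hci⟩ := hqm.exists_inv heq
        apply hyq
        have h4 : y = c * (e * y) + y * i := by linear_combination -y * hci
        rw [h4]
        exact Ideal.add_mem _ (Ideal.mul_mem_left _ _ h3) (Ideal.mul_mem_mul hy hi)
      · rw [Ideal.add_mem_iff_left]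
        · exact hxT p hp
        · rw [mul_comm e]
          exact Ideal.mul_mem_mul hy (heT p hp)

/-- A maximal `p` containing both the cofactor `b` and `d` would give `y ∈ ab ⊆ ap`. -/
theorem exists_mul_eq_span_sup_eq_top {a d : Ideal R} (ha : IsUnit (a : FractionalIdeal R⁰ K))
    {y : R} (hy : y ∈ a) (h : ∀ p : Ideal R, p.IsMaximal → d ≤ p → y ∉ a * p) :
    ∃ b : Ideal R, a * b = Ideal.span {y} ∧ b ⊔ d = ⊤ := by
  obtain ⟨b, hb⟩ := exists_mul_eq_span ha hy
  refine ⟨b, hb, ?_⟩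
  by_contra hbd
  obtain ⟨p, hp, hle⟩ := Ideal.exists_le_maximal _ hbd
  refine h p hp (le_sup_right.trans hle) (Ideal.mul_mono_right (le_sup_left.trans hle) ?_)
  rw [hb]
  exact Ideal.mem_span_singleton_self y

/-- For an invertible ideal `a` coprime to `m`, the inverse class contains, modulo elements
congruent to `1` modulo `m`, an ideal coprime to a given nonzero ideal `d`. -/
theorem exists_forall_mul_eq_span [Ring.HasFiniteQuotients R] {a m d : Ideal R}
    (ha : IsUnit (a : FractionalIdeal R⁰ K)) (hm : a ⊔ m = ⊤) (hd : d ≠ ⊥) :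
    ∃ x ∈ a, 1 - x ∈ m ∧ ∀ z ∈ a * d, ∃ b : Ideal R, a * b = Ideal.span {x + z} ∧ b ⊔ d = ⊤ := by
  classical
  obtain ⟨c, hc, hc0⟩ := Submodule.exists_mem_ne_zero_of_ne_bot hd
  have hfin : {p : Ideal R | p.IsMaximal ∧ d ≤ p ∧ ¬ m ≤ p}.Finite :=
    (Ring.HasFiniteQuotients.finite_setOfPred_mem c hc0).subset fun p hp => hp.2.1 hc
  obtain ⟨x, hx, hxm, hxT⟩ := exists_mem_notMem_mul ha hm hfin.toFinset fun p hp =>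
    ⟨(hfin.mem_toFinset.1 hp).1, (hfin.mem_toFinset.1 hp).2.2⟩
  refine ⟨x, hx, hxm, fun z hz => ?_⟩
  have hza : z ∈ a := (Ideal.mul_le_left : a * d ≤ a) hz
  refine exists_mul_eq_span_sup_eq_top ha (a.add_mem hx hza) fun p hp hdp => ?_
  have hzp : z ∈ a * p := (Ideal.mul_mono_right hdp : a * d ≤ a * p) hz
  rw [Ideal.add_mem_iff_left _ hzp]
  -- Maximal ideals containing `m` need no choice: `x ≡ 1` modulo `m` already keeps `x` out of them.
  by_cases hmp : m ≤ p
  · intro h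
    have hxp : x ∈ p := (Ideal.mul_le_right : a * p ≤ p) h
    refine hp.ne_top ((Ideal.eq_top_iff_one _).2 ?_)
    rw [← sub_add_cancel 1 x]
    exact p.add_mem (hmp hxm) hxp
  · exact hxT p (hfin.mem_toFinset.2 ⟨hp, hdp, hmp⟩)

end Invertible

/-! ### Prescribing signs at the real embeddings -/

section Signs

variable {K : Type*} [Field K] [NumberField K]

open NumberField in
-- Weak approximation at the infinite places: distinct real embeddings give distinct places, so
-- their signs are independent.
theorem exists_forall_pos_iff (s : (K →+* ℝ) → Prop) :
    ∃ y : K, y ≠ 0 ∧ ∀ ρ, 0 < ρ y ↔ s ρ := by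
  classical
  let v (ρ : K →+* ℝ) : InfinitePlace K := InfinitePlace.mk (Complex.ofRealHom.comp ρ)
  have hv : Function.Injective v := by
    intro ρ σ h
    rcases InfinitePlace.mk_eq_iff.1 h with h | h
    · ext x
      simpa using congr($h x)
    · ext x
      simpa using congr($h x)
  -- The target is `±1`, so that an error smaller than `1` preserves its sign.
  let t (w : InfinitePlace K) : K := if ∃ ρ, v ρ = w ∧ ¬ s ρ then -1 else 1
  obtain ⟨y, hy⟩ : ∃ y : K, ∀ w : InfinitePlace K, w (y - t w) < 1 := by
    obtain ⟨y, hy⟩ := (InfinitePlace.denseRange_algebraMap_pi K).exists_dist_lt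
      (fun w => WithAbs.toAbs w.1 (t w)) one_pos
    refine ⟨y, fun w => ?_⟩
    have h := (dist_pi_lt_iff one_pos).1 hy w
    rw [dist_comm, dist_eq_norm] at h
    exact h
  refine ⟨y, ?_, fun ρ => ?_⟩
  · rintro rfl
    -- Zero is at distance exactly `1` from the target at any infinite place, and one exists even if
    -- no embedding is real.
    obtain ⟨w⟩ : Nonempty (InfinitePlace K) := inferInstance
    have h1 : w (-1) = 1 := (w.1.map_neg 1).trans w.1.map_one
    have := hy w
    by_cases h : ∃ ρ, v ρ = w ∧ ¬ s ρ <;> simp [t, h, h1] at this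
  · have h1 := hy (v ρ)
    have h2 : v ρ (y - t (v ρ)) = |ρ y - ρ (t (v ρ))| := by
      refine (InfinitePlace.apply _ _).trans ?_
      rw [RingHom.comp_apply, Complex.ofRealHom_eq_coe, Complex.norm_real, map_sub,
        Real.norm_eq_abs]
    rw [h2, abs_lt] at h1
    by_cases h : s ρ
    · have : t (v ρ) = 1 := if_neg (by
        rintro ⟨σ, hσ, hs⟩
        exact hs (hv hσ ▸ h))
      rw [this, map_one] at h1
      exact iff_of_true (by linarith) h
    · have : t (v ρ) = -1 := if_pos ⟨ρ, rfl, h⟩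
      rw [this, map_neg, map_one] at h1
      exact iff_of_false (by linarith) h

instance : Finite (K →+* ℝ) :=
  Finite.of_injective (β := K →+* ℂ) (fun ρ => Complex.ofRealHom.comp ρ) fun ρ σ h => by
    ext x
    simpa using congr($h x)

theorem exists_mem_forall_pos_iff {O : Subring K} [IsFractionRing O K] {I : Ideal O} (hI : I ≠ ⊥)
    (x : O) (s : (K →+* ℝ) → Prop) :
    ∃ z ∈ I, x + z ≠ 0 ∧ ∀ ρ : K →+* ℝ, 0 < ρ ((x + z : O) : K) ↔ s ρ := by
  obtain ⟨y, hy0, hy⟩ := exists_forall_pos_iff s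
  obtain ⟨i, hi, hi0⟩ := Submodule.exists_mem_ne_zero_of_ne_bot hI
  obtain ⟨a, b, hb, hab⟩ := IsFractionRing.div_surjective (A := O) y
  have hab' : (a : K) = y * b := by
    rw [← hab]
    exact (div_mul_cancel₀ _ (by simpa using nonZeroDivisors.ne_zero hb)).symm
  have hb0 : (b : K) ≠ 0 := by simpa using nonZeroDivisors.ne_zero hb
  have hi0' : (i : K) ≠ 0 := by simpa using hi0
  -- This is `y` times the square `(b * i) ^ 2`: it lies in `I` and has the signs of `y`. For large
  -- `n`, the signs of `x + n * c` are those of `c`.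
  let c : O := a * b * i * i
  have hc : (c : K) = y * (b * i) ^ 2 := by
    simp only [c, Subring.coe_mul, hab']
    ring
  have hc0 : c ≠ 0 := by
    intro h
    have : (c : K) = 0 := by rw [h]; rfl
    rw [hc] at this
    simp_all
  have hcs (ρ : K →+* ℝ) : 0 < ρ (c : K) ↔ s ρ := by
    rw [hc, ← hy, map_mul, map_pow]
    exact mul_pos_iff_of_pos_right (by
      have : ρ (b * i) ≠ 0 := by simp [hb0, hi0']
      positivity)
  have h1 (ρ : K →+* ℝ) : ∀ᶠ n : ℕ in Filter.atTop, 0 < ρ ((x + n * c : O) : K) ↔ s ρ := by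
    have e (n : ℕ) : ρ ((x + n * c : O) : K) = ρ (x : K) + n * ρ (c : K) := by simp
    simp only [e, ← hcs]
    have hcρ : ρ (c : K) ≠ 0 := by simpa using hc0
    rcases lt_or_gt_of_ne hcρ with h | h
    · have := (tendsto_natCast_atTop_atTop (R := ℝ)).atTop_mul_const_of_neg h
      filter_upwards [this.eventually_lt_atBot (-ρ (x : K))] with n hn
      exact iff_of_false (by linarith) h.not_gt
    · have := (tendsto_natCast_atTop_atTop (R := ℝ)).atTop_mul_const h
      filter_upwards [this.eventually_gt_atTop (-ρ (x : K))] with n hn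
      exact iff_of_true (by linarith) h
  -- The sign conditions do not imply this when there are no real embeddings.
  have h2 : ∀ᶠ n : ℕ in Filter.atTop, x + n * c ≠ 0 := by
    have hinj : Function.Injective fun n : ℕ => x + n * c := by
      intro n k h
      have : (n : O) * c = k * c := add_left_cancel h
      exact_mod_cast mul_right_cancel₀ hc0 this
    rw [← Nat.cofinite_eq_atTop]
    exact hinj.tendsto_cofinite.eventually (Set.finite_singleton (0 : O)).eventually_cofinite_notMem
  obtain ⟨n, hn, hn'⟩ := (h2.and (Filter.eventually_all.2 h1)).exists
  exact ⟨n * c, I.mul_mem_left _ (I.mul_mem_left _ hi), hn, hn'⟩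

end Signs

theorem IsOrder.hasFiniteQuotients {K : Type*} [Field K] [NumberField K] {O : Subring K}
    (h : IsOrder O) : Ring.HasFiniteQuotients O where
  finiteQuotient {I} hI := by
    have := h.finite
    have : Module.Free ℤ O := inferInstance
    exact I.finiteQuotientOfFreeOfNeBot hI

/-! ### Residues, signs and congruences on representatives -/

section Residue

variable {R R' : Type*} [CommRing R] [CommRing R']

theorem isUnit_mk_iff {d : Ideal R} {x : R} :
    IsUnit (Ideal.Quotient.mk d x) ↔ Ideal.span {x} ⊔ d = ⊤ := by
  constructor
  · intro h
    obtain ⟨y, hy⟩ := h.exists_right_inv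
    obtain ⟨y, rfl⟩ := Ideal.Quotient.mk_surjective y
    refine sup_eq_top_of_one_sub_mem (Ideal.mul_mem_right y _ (Ideal.mem_span_singleton_self x)) ?_
    rw [← Ideal.Quotient.eq, map_mul, hy, map_one]
  · intro h
    obtain ⟨y, hy, hy'⟩ := exists_mem_one_sub_mem h
    obtain ⟨z, rfl⟩ := Ideal.mem_span_singleton'.1 hy
    refine IsUnit.of_mul_eq_one (Ideal.Quotient.mk d z) ?_
    rw [← map_mul, mul_comm, eq_comm, ← map_one (Ideal.Quotient.mk d), Ideal.Quotient.eq]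
    exact hy'

theorem mem_residueUnits_iff {m d : Ideal R} (hdm : d ≤ m) {v : (R ⧸ d)ˣ} {x : R}
    (hv : (v : R ⧸ d) = Ideal.Quotient.mk d x) : v ∈ residueUnits m d ↔ x - 1 ∈ m := by
  rw [mem_unitsMod, hv, ← map_one (Ideal.Quotient.mk d), ← map_sub,
    Ideal.mem_quotient_iff_mem hdm]

theorem mem_range_residueMap_iff (φ : R →+* R') {m : Ideal R} {m' : Ideal R'} (hm : m.map φ ≤ m')
    {d : Ideal R'} (hdm : d.comap φ ≤ m) (v : residueUnits m' d) :
    v ∈ (residueMap φ hm d).range ↔ ∃ w : R, w - 1 ∈ m ∧ Ideal.span {w} ⊔ d.comap φ = ⊤ ∧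
      ((v : (R' ⧸ d)ˣ) : R' ⧸ d) = Ideal.Quotient.mk d (φ w) := by
  constructor
  · rintro ⟨⟨u, hu⟩, rfl⟩
    obtain ⟨w, hw⟩ := Ideal.Quotient.mk_surjective (u : R ⧸ d.comap φ)
    refine ⟨w, (mem_residueUnits_iff hdm hw.symm).1 hu, isUnit_mk_iff.1 (hw ▸ u.isUnit), ?_⟩
    change Ideal.quotientMap d φ le_rfl (u : R ⧸ d.comap φ) = _
    rw [← hw, Ideal.quotientMap_mk]
  · rintro ⟨w, hwm, hw, hv⟩
    obtain ⟨u, hu⟩ := isUnit_mk_iff.2 hw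
    refine ⟨⟨u, (mem_residueUnits_iff hdm hu).2 hwm⟩, Subtype.ext (Units.ext ?_)⟩
    change Ideal.quotientMap d φ le_rfl (u : R ⧸ d.comap φ) = _
    rw [hu, hv, Ideal.quotientMap_mk]

end Residue

section SignMap

variable {K : Type*} [Field K] {S : Set (K →+* ℝ)}

theorem signs_mul {x y : K} (hx : x ≠ 0) (hy : y ≠ 0) :
    signs S (x * y) = signs S x * signs S y := by
  funext ρ
  have hx' : ρ.1 x ≠ 0 := by simpa using hx
  have hy' : ρ.1 y ≠ 0 := by simpa using hy
  simp only [signs, Pi.mul_apply, map_mul]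
  rcases hx'.lt_or_gt with h | h <;> rcases hy'.lt_or_gt with h' | h'
  · simp [h.not_gt, h'.not_gt, mul_pos_of_neg_of_neg h h']
  · simp [h.not_gt, h', (mul_neg_of_neg_of_pos h h').not_gt]
  · simp [h, h'.not_gt, (mul_neg_of_pos_of_neg h h').not_gt]
  · simp [h, h', mul_pos h h']

theorem signs_eq_iff {x : K} {s : S → ℤˣ} : signs S x = s ↔ ∀ ρ, 0 < ρ.1 x ↔ s ρ = 1 := by
  rw [funext_iff]
  refine forall_congr' fun ρ => ?_
  unfold signs
  rcases Int.units_eq_one_or (s ρ) with h | h <;> split_ifs with h' <;> simp [h, h']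

end SignMap

section Congruences

variable {K : Type*} [Field K] {O : Subring K}

/-- The denominator is invertible modulo `m`, so on `O` the congruence of fractions is the ordinary
one. -/
theorem mem_of_modCong_one {m : Ideal O} {w : O} (h : ModCong m (w : K) 1) : w - 1 ∈ m := by
  obtain ⟨a, b, hb, hbm, h1, h2⟩ := modCong_one_iff.1 h
  have hb' : (b : K) ≠ 0 := by simpa using hb
  have h3 : a = w * b := by
    apply Subtype.ext
    rw [Subring.coe_mul, h1, div_mul_cancel₀ _ hb']
  obtain ⟨x, hx, hx'⟩ := exists_mem_one_sub_mem hbm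
  obtain ⟨z, rfl⟩ := Ideal.mem_span_singleton'.1 hx
  have h4 : w - 1 = z * (a - b) + (w - 1) * (1 - z * b) := by rw [h3]; ring
  rw [h4]
  exact m.add_mem (m.mul_mem_left _ h2) (m.mul_mem_left _ hx')

theorem modCong_one_of_sub_mem {m : Ideal O} {w : O} (h : w - 1 ∈ m) : ModCong m (w : K) 1 :=
  modCong_one_iff.2 ⟨w, 1, one_ne_zero, by simp, by simp, h⟩

theorem rayElements_le {O' : Subring K} (hO : O ≤ O') {m : Ideal O} {m' : Ideal O'}
    (hm : m.map (Subring.inclusion hO) ≤ m') {S S' : Set (K →+* ℝ)} (hS : S' ⊆ S) :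
    rayElements m S ≤ rayElements m' S' := by
  rintro α ⟨h, h'⟩
  refine ⟨?_, fun ρ hρ => h' ρ (hS hρ)⟩
  obtain ⟨a, b, hb, hbm, h1, h2⟩ := modCong_one_iff.1 h
  refine modCong_one_iff.2 ⟨Subring.inclusion hO a, Subring.inclusion hO b, ?_, ?_, h1, ?_⟩
  · rwa [ne_eq, map_eq_zero_iff _ (Subring.inclusion_injective hO)]
  · have := map_sup_eq_top _ hbm hm
    rwa [Ideal.map_span, Set.image_singleton] at this
  · rw [← map_sub]
    exact hm (Ideal.mem_map_of_mem _ h2)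

end Congruences

/-! ### Ray classes of integral ideals -/

section IntegralClasses

variable {K : Type*} [Field K] {O : Subring K}

/-- The invertible integral ideals coprime to `m`. -/
def integralIdeals (m : Ideal O) : Submonoid (Ideal O) where
  carrier := {a | IsUnit (a : FractionalIdeal O⁰ K) ∧ a ⊔ m = ⊤}
  one_mem' := ⟨by simp, by simp⟩
  mul_mem' := fun ⟨ha, ha'⟩ ⟨hb, hb'⟩ =>
    ⟨by rw [FractionalIdeal.coeIdeal_mul]; exact ha.mul hb, sup_mul_eq_top ha' hb'⟩

theorem integralIdeals_mono {d m : Ideal O} (h : d ≤ m) : integralIdeals d ≤ integralIdeals m :=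
  fun _ ⟨ha, ha'⟩ => ⟨ha, top_le_iff.1 (ha'.symm.trans_le (sup_le_sup_left h _))⟩

variable [IsFractionRing O K]

/-- An invertible integral ideal coprime to `m` as an element of `J*_m(O)`. -/
noncomputable def toCoprimeIdeals (m : Ideal O) : integralIdeals m →* coprimeIdeals (K := K) m where
  toFun a := ⟨a.2.1.unit, isCoprimeTo_iff.2 ⟨a, ⊤, a.2.2, by simp, by simp, by simp⟩⟩
  map_one' := Subtype.ext (Units.ext (by simp))
  map_mul' a b := Subtype.ext (Units.ext (by simp))

@[simp]
theorem coe_toCoprimeIdeals (m : Ideal O) (a : integralIdeals m) :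
    ((toCoprimeIdeals m a : (FractionalIdeal O⁰ K)ˣ) : FractionalIdeal O⁰ K) = (a : Ideal O) := rfl

/-- The ray class of an invertible integral ideal coprime to `m`. -/
noncomputable def integralClass (m : Ideal O) (S : Set (K →+* ℝ)) :
    integralIdeals m →* RayClassGroup m S :=
  (QuotientGroup.mk' _).comp (toCoprimeIdeals m)

/-- A generator of an integral ideal lies in `O`, so fractions disappear from the triviality
criterion. -/
theorem integralClass_eq_one_iff {m : Ideal O} {S : Set (K →+* ℝ)} {a : integralIdeals m} :
    integralClass m S a = 1 ↔ ∃ w : O, w ≠ 0 ∧ w - 1 ∈ m ∧ (∀ ρ ∈ S, 0 < ρ (w : K)) ∧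
      (a : Ideal O) = Ideal.span {w} := by
  have h : integralClass m S a = 1 ↔
      ∃ γ ∈ rayElements m S, toPrincipalIdeal O K γ = (toCoprimeIdeals m a : _) := by
    change (QuotientGroup.mk (toCoprimeIdeals m a) : RayClassGroup m S) = 1 ↔ _
    rw [QuotientGroup.eq_one_iff, Subgroup.mem_subgroupOf]
    rfl
  rw [h]
  constructor
  · rintro ⟨γ, ⟨hγ, hγ'⟩, e⟩
    have e' := (toPrincipalIdeal_eq_iff).1 e
    rw [coe_toCoprimeIdeals] at e'
    obtain ⟨w, -, hw⟩ := (FractionalIdeal.mem_coeIdeal _).1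
      (e' ▸ FractionalIdeal.mem_spanSingleton_self O⁰ (γ : K))
    change (w : K) = γ at hw
    rw [← hw] at hγ hγ' e'
    refine ⟨w, ?_, mem_of_modCong_one hγ, hγ', FractionalIdeal.coeIdeal_injective (K := K) ?_⟩
    · rintro rfl
      exact γ.ne_zero hw.symm
    · exact e'.symm.trans (FractionalIdeal.coeIdeal_span_singleton w).symm
  · rintro ⟨w, hw0, hw, hw', e⟩
    have hw0' : (w : K) ≠ 0 := by simpa using hw0
    refine ⟨Units.mk0 (w : K) hw0', ⟨modCong_one_of_sub_mem hw, hw'⟩, toPrincipalIdeal_eq_iff.2 ?_⟩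
    rw [coe_toCoprimeIdeals, e, FractionalIdeal.coeIdeal_span_singleton]
    rfl

variable [NumberField K]

/-- The generator supplied by the moving lemma is free modulo `ad`, and this freedom makes it
positive on `S` while keeping it `1` modulo `m`. -/
theorem exists_integralClass_mul_eq_one [Ring.HasFiniteQuotients O] {m d : Ideal O} (hd : d ≠ ⊥)
    (hdm : d ≤ m) (S : Set (K →+* ℝ)) (a : integralIdeals m) :
    ∃ b : integralIdeals m, (b : Ideal O) ⊔ d = ⊤ ∧
      integralClass m S a * integralClass m S b = 1 := by
  obtain ⟨x, -, hxm, hx⟩ := exists_forall_mul_eq_span a.2.1 a.2.2 hd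
  have had : (a : Ideal O) * d ≠ ⊥ := by
    refine mul_ne_zero ?_ hd
    intro h
    exact a.2.1.ne_zero (by rw [h]; simp)
  obtain ⟨z, hz, h0, hpos⟩ := exists_mem_forall_pos_iff had x (· ∈ S)
  obtain ⟨b, hab, hb⟩ := hx z hz
  have hbu : IsUnit (b : FractionalIdeal O⁰ K) :=
    isUnit_coeIdeal_of_mul_eq_span h0 (by rw [mul_comm]; exact hab)
  have hzm : z ∈ m := hdm ((Ideal.mul_le_right : (a : Ideal O) * d ≤ d) hz)
  refine ⟨⟨b, integralIdeals_mono hdm ⟨hbu, hb⟩⟩, hb, ?_⟩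
  rw [← map_mul, integralClass_eq_one_iff]
  refine ⟨x + z, h0, ?_, fun ρ hρ => (hpos ρ).2 hρ, hab⟩
  have : x + z - 1 = z - (1 - x) := by ring
  rw [this]
  exact m.sub_mem hzm hxm

/-- Every ray class contains an invertible integral ideal coprime to a given nonzero ideal. -/
theorem exists_integralClass_eq [Ring.HasFiniteQuotients O] {m d : Ideal O} (hd : d ≠ ⊥)
    (hdm : d ≤ m) (S : Set (K →+* ℝ)) (c : RayClassGroup m S) :
    ∃ a : integralIdeals m, (a : Ideal O) ⊔ d = ⊤ ∧ integralClass m S a = c := by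
  obtain ⟨c, rfl⟩ := QuotientGroup.mk_surjective c
  obtain ⟨a, b, ha, hb, hbu, hc⟩ := isCoprimeTo_iff.1 c.2
  have hau : IsUnit (a : FractionalIdeal O⁰ K) := by
    rw [← hc]
    exact c.1.isUnit.mul hbu
  let a₀ : integralIdeals m := ⟨a, hau, ha⟩
  let b₀ : integralIdeals m := ⟨b, hbu, hb⟩
  have h : c * toCoprimeIdeals m b₀ = toCoprimeIdeals m a₀ := Subtype.ext (Units.ext hc)
  have h' : (QuotientGroup.mk c : RayClassGroup m S) * integralClass m S b₀ = integralClass m S a₀ :=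
    congr_arg (QuotientGroup.mk : _ → RayClassGroup m S) h
  -- The class is `[a₀][b₀]⁻¹`. Inverting `b₀` once and `a₀` twice makes both factors integral and
  -- coprime to `d`.
  obtain ⟨b₁, hb₁, hbb⟩ := exists_integralClass_mul_eq_one hd hdm S b₀
  obtain ⟨a₁, ha₁, haa⟩ := exists_integralClass_mul_eq_one hd hdm S a₀
  obtain ⟨a₂, ha₂, haa'⟩ := exists_integralClass_mul_eq_one hd hdm S a₁
  refine ⟨a₂ * b₁, sup_mul_eq_top ha₂ hb₁, ?_⟩
  have e : integralClass m S a₂ = integralClass m S a₀ :=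
    (eq_inv_of_mul_eq_one_right haa').trans (eq_inv_of_mul_eq_one_left haa).symm
  rw [map_mul, e, ← h', mul_assoc, hbb]
  exact mul_one (QuotientGroup.mk c : RayClassGroup m S)

end IntegralClasses

/-! ### Contraction of invertible ideals -/

section Contraction

variable {K : Type*} [Field K] [NumberField K] {O O' : Subring K} [IsFractionRing O K]
  [IsFractionRing O' K] (hO : O ≤ O') {d : Ideal O'}

/-- Some nonzero `t ∈ A` is `1` modulo `d`, hence lies in `O`. Its cofactor `B` in `AB = tO'` is
also coprime to `d`, so contracting gives `(A ∩ O)(B ∩ O) = tO`. -/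
theorem comap_mem_integralIdeals (hd0 : d ≠ ⊥)
    (hd : ∀ x ∈ d, x ∈ (Subring.inclusion hO).range) {A : Ideal O'} (hA : A ∈ integralIdeals d) :
    A.comap (Subring.inclusion hO) ∈ integralIdeals (d.comap (Subring.inclusion hO)) := by
  refine ⟨?_, comap_sup_comap_eq_top hd hA.2⟩
  obtain ⟨x, hx, hx'⟩ := exists_mem_one_sub_mem hA.2
  have hAd : A * d ≠ ⊥ := by
    refine mul_ne_zero ?_ hd0
    rintro rfl
    exact hA.1.ne_zero (by simp)
  -- Only the nonvanishing of `x + z` is wanted; the signs are discarded.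
  obtain ⟨z, hz, h0, -⟩ := exists_mem_forall_pos_iff hAd x fun _ => True
  have hzA : z ∈ A := (Ideal.mul_le_left : A * d ≤ A) hz
  have hzd : z ∈ d := (Ideal.mul_le_right : A * d ≤ d) hz
  have h1 : 1 - (x + z) ∈ d := by
    rw [← sub_sub]
    exact d.sub_mem hx' hzd
  obtain ⟨B, hB⟩ := exists_mul_eq_span hA.1 (A.add_mem hx hzA)
  have hBd : B ⊔ d = ⊤ := by
    refine sup_eq_top_of_one_sub_mem ((Ideal.mul_le_right : A * B ≤ B) ?_) h1
    rw [hB]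
    exact Ideal.mem_span_singleton_self _
  obtain ⟨y, hy⟩ := hd _ h1
  have hy' : x + z = Subring.inclusion hO (1 - y) := by
    rw [map_sub, map_one, hy, sub_sub_cancel]
  refine isUnit_coeIdeal_of_mul_eq_span (b := B.comap (Subring.inclusion hO)) (y := 1 - y) ?_ ?_
  · intro h
    exact h0 (by rw [hy', h, map_zero])
  · rw [← comap_mul_of_sup_eq_top (Subring.inclusion_injective hO) hd hA.2 hBd, hB, hy',
      ← Set.image_singleton, ← Ideal.map_span]
    refine comap_map_eq_of_sup_eq_top (Subring.inclusion_injective hO) hd ?_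
    refine sup_eq_top_of_one_sub_mem (Ideal.mem_span_singleton_self _) ?_
    rwa [sub_sub_cancel, Ideal.mem_comap, hy]

/-- Contraction of invertible ideals coprime to `d`. -/
noncomputable def contraction (hd0 : d ≠ ⊥) (hd : ∀ x ∈ d, x ∈ (Subring.inclusion hO).range)
    {m : Ideal O} (hdm : d.comap (Subring.inclusion hO) ≤ m) :
    integralIdeals d →* integralIdeals m where
  toFun A := ⟨(A : Ideal O').comap (Subring.inclusion hO),
    integralIdeals_mono hdm (comap_mem_integralIdeals hO hd0 hd A.2)⟩
  map_one' := Subtype.ext (by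
    change Ideal.comap (Subring.inclusion hO) (1 : Ideal O') = 1
    rw [Ideal.one_eq_top, Ideal.comap_top, Ideal.one_eq_top])
  map_mul' A B := Subtype.ext
    (comap_mul_of_sup_eq_top (Subring.inclusion_injective hO) hd A.2.2 B.2.2)

end Contraction

/-! ### Extension of fractional ideals and of ray classes -/

section Extension

variable {K : Type*} [Field K] {O O' : Subring K} (hO : O ≤ O')

theorem nonZeroDivisors_le_comap_inclusion : O⁰ ≤ O'⁰.comap (Subring.inclusion hO) :=
  nonZeroDivisors_le_comap_nonZeroDivisors_of_injective _ (Subring.inclusion_injective hO)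

variable [IsFractionRing O K] [IsFractionRing O' K]

theorem isLocalization_map_inclusion (x : K) :
    IsLocalization.map K (Subring.inclusion hO) (nonZeroDivisors_le_comap_inclusion hO) x = x := by
  have : IsLocalization.map K (Subring.inclusion hO) (nonZeroDivisors_le_comap_inclusion hO)
      = RingHom.id K :=
    IsLocalization.ringHom_ext O⁰ (by
      ext y
      simp only [RingHom.comp_apply, IsLocalization.map_eq]
      rfl)
  rw [this, RingHom.id_apply]

/-- The extension `a ↦ aO'` of fractional ideals. -/
noncomputable def extension : FractionalIdeal O⁰ K →+* FractionalIdeal O'⁰ K :=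
  FractionalIdeal.extendedHom' K (nonZeroDivisors_le_comap_inclusion hO)

theorem coe_extension (a : FractionalIdeal O⁰ K) :
    (extension hO a : Set K) = Submodule.span O' (a : Set K) := by
  have h := FractionalIdeal.coe_extended_eq_span K (nonZeroDivisors_le_comap_inclusion hO) a
  simp only [isLocalization_map_inclusion, Set.image_id'] at h
  rw [← h]
  rfl

theorem extension_coeIdeal (a : Ideal O) :
    extension hO (a : FractionalIdeal O⁰ K) = (a.map (Subring.inclusion hO) : Ideal O') :=
  FractionalIdeal.extended_coeIdeal_eq_map K _ a

theorem extension_spanSingleton (x : K) :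
    extension hO (FractionalIdeal.spanSingleton O⁰ x) = FractionalIdeal.spanSingleton O'⁰ x := by
  refine (FractionalIdeal.extended_spanSingleton K _ x).trans ?_
  rw [isLocalization_map_inclusion]

variable {m : Ideal O} {m' : Ideal O'}

theorem isCoprimeTo_extension (hm : m.map (Subring.inclusion hO) ≤ m')
    {c : FractionalIdeal O⁰ K} (hc : IsCoprimeTo m c) :
    IsCoprimeTo m' (extension hO c) := by
  obtain ⟨a, b, ha, hb, hbu, e⟩ := isCoprimeTo_iff.1 hc
  refine isCoprimeTo_iff.2 ⟨a.map (Subring.inclusion hO), b.map (Subring.inclusion hO),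
    map_sup_eq_top _ ha hm, map_sup_eq_top _ hb hm, ?_, ?_⟩
  · rw [← extension_coeIdeal]
    exact hbu.map _
  · rw [← extension_coeIdeal, ← extension_coeIdeal, ← map_mul, e]

variable (hm : m.map (Subring.inclusion hO) ≤ m')

/-- The extension `J*_m(O) → J*_{m'}(O')`. -/
noncomputable def extensionCoprime : coprimeIdeals (K := K) m →* coprimeIdeals (K := K) m' :=
  ((Units.map (extension hO : FractionalIdeal O⁰ K →* FractionalIdeal O'⁰ K)).comp
    (coprimeIdeals m).subtype).codRestrict _ fun c => isCoprimeTo_extension hO hm c.2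

/-- The extension map on ray class groups. -/
noncomputable def extensionClass {S S' : Set (K →+* ℝ)} (hS : S' ⊆ S) :
    RayClassGroup m S →* RayClassGroup m' S' :=
  QuotientGroup.map _ _ (extensionCoprime hO hm) (by
    rintro c ⟨γ, hγ, e⟩
    refine ⟨γ, rayElements_le hO hm hS hγ, Units.ext ?_⟩
    have e' := congr_arg Units.val e
    rw [coe_toPrincipalIdeal] at e' ⊢
    rw [← extension_spanSingleton hO, e']
    rfl)

/-- The extension of integral ideals. -/
def extensionIntegral (a : integralIdeals m) : integralIdeals m' :=
  ⟨(a : Ideal O).map (Subring.inclusion hO), by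
    rw [← extension_coeIdeal]
    exact a.2.1.map _, map_sup_eq_top _ a.2.2 hm⟩

theorem extensionClass_integralClass {S S' : Set (K →+* ℝ)} (hS : S' ⊆ S) (a : integralIdeals m) :
    extensionClass hO hm hS (integralClass m S a)
      = integralClass m' S' (extensionIntegral hO hm a) :=
  congr_arg (QuotientGroup.mk : _ → RayClassGroup m' S')
    (Subtype.ext (Units.ext (extension_coeIdeal hO _)))

end Extension

/-- Used to build `g`. The source has no inverses, but if `φ x = φ y`, some `z` has `φ z` inverse to
both, whence `ψ x * ψ z = 1 = ψ y * ψ z`. -/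
theorem exists_comp_eq_of_surjective {M L C : Type*} [MulOneClass M] [MulOneClass L] [Group C]
    {φ : M →* L} {ψ : M →* C} (hL : ∀ a : L, ∃ b, a * b = 1) (hφ : Function.Surjective φ)
    (h : ∀ x, φ x = 1 → ψ x = 1) : ∃ g : L →* C, ∀ x, g (φ x) = ψ x := by
  have key : ∀ x y, φ x = φ y → ψ x = ψ y := by
    intro x y hxy
    obtain ⟨b, hb⟩ := hL (φ x)
    obtain ⟨z, rfl⟩ := hφ b
    have h1 : ψ x * ψ z = 1 := by rw [← map_mul, h _ (by rw [map_mul, hb])]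
    have h2 : ψ y * ψ z = 1 := by rw [← map_mul, h _ (by rw [map_mul, ← hxy, hb])]
    exact mul_right_cancel (h1.trans h2.symm)
  choose s hs using hφ
  refine ⟨⟨⟨fun l => ψ (s l), ?_⟩, fun a b => ?_⟩, fun x => key _ _ (hs _)⟩
  · exact h _ (hs 1)
  · change ψ (s (a * b)) = ψ (s a) * ψ (s b)
    rw [← map_mul]
    exact key _ _ (by rw [map_mul, hs, hs, hs])

/-- A homomorphism that is trivial on the normal subgroup `N` factors through `G ⧸ N`; here the
codomain is only required to have a multiplication with a unit. -/
def quotientLift {G L : Type*} [Group G] [MulOneClass L] (N : Subgroup G) [N.Normal] (φ : G →* L)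
    (h : ∀ u ∈ N, φ u = 1) : G ⧸ N →* L where
  toFun := Quotient.lift φ fun a b hab => by
    have e : b = a * (a⁻¹ * b) := (mul_inv_cancel_left a b).symm
    rw [e, map_mul, h _ (QuotientGroup.leftRel_apply.1 hab), mul_one]
  map_one' := map_one φ
  map_mul' := by
    rintro ⟨a⟩ ⟨b⟩
    exact map_mul φ a b

/-! ### The monoid of elements that presents the middle term -/

section CongruenceElements

variable {K : Type*} [Field K] {O : Subring K}

/-- The nonzero elements of `O` that are units modulo `d`, congruent to `1` modulo `m` and positive
under the embeddings in `S`. -/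
def congruenceElements (d m : Ideal O) (S : Set (K →+* ℝ)) : Submonoid O where
  carrier := {α | α ≠ 0 ∧ Ideal.span {α} ⊔ d = ⊤ ∧ α - 1 ∈ m ∧ ∀ ρ ∈ S, 0 < ρ (α : K)}
  one_mem' := ⟨one_ne_zero, by simp, by simp, by simp⟩
  mul_mem' := by
    rintro α β ⟨h1, h2, h3, h4⟩ ⟨k1, k2, k3, k4⟩
    refine ⟨mul_ne_zero h1 k1, ?_, ?_, fun ρ hρ => by simpa using mul_pos (h4 ρ hρ) (k4 ρ hρ)⟩
    · rw [← Ideal.span_singleton_mul_span_singleton]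
      exact sup_mul_eq_top h2 k2
    · have : α * β - 1 = α * (β - 1) + (α - 1) := by ring
      rw [this]
      exact m.add_mem (m.mul_mem_left _ k3) h3

variable {d m : Ideal O} {S : Set (K →+* ℝ)}

/-- The residue class modulo `d`, as an element of `U_m(O/d)`. -/
noncomputable def residue (hdm : d ≤ m) : congruenceElements d m S →* residueUnits m d where
  toFun α := ⟨(isUnit_mk_iff.2 α.2.2.1).unit, (mem_residueUnits_iff hdm (by simp)).2 α.2.2.2.1⟩
  map_one' := Subtype.ext (Units.ext (by simp))
  map_mul' α β := Subtype.ext (Units.ext (by simp))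

theorem coe_residue (hdm : d ≤ m) (α : congruenceElements d m S) :
    ((residue hdm α : (O ⧸ d)ˣ) : O ⧸ d) = Ideal.Quotient.mk d α := rfl

theorem coe_ne_zero {α : O} (h : α ≠ 0) : (α : K) ≠ 0 := by simpa using h

/-- The signs of the elements of `congruenceElements`. -/
noncomputable def signsHom (T : Set (K →+* ℝ)) : congruenceElements d m S →* (T → ℤˣ) where
  toFun α := signs T ((α : O) : K)
  map_one' := signs_eq_iff.2 fun ρ => by simp
  map_mul' α β := signs_mul (coe_ne_zero α.2.1) (coe_ne_zero β.2.1)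

theorem span_mem_integralIdeals [IsFractionRing O K] {α : O} (h0 : α ≠ 0)
    (h : Ideal.span {α} ⊔ d = ⊤) : Ideal.span {α} ∈ integralIdeals d :=
  ⟨isUnit_coeIdeal_of_mul_eq_span (b := ⊤) h0 (by simp), h⟩

/-- The principal ideal generated by an element of `congruenceElements`. -/
def spanHom [IsFractionRing O K] : congruenceElements d m S →* integralIdeals d where
  toFun α := ⟨Ideal.span {(α : O)}, span_mem_integralIdeals α.2.1 α.2.2.1⟩
  map_one' := Subtype.ext (by simp)
  map_mul' α β := Subtype.ext (Ideal.span_singleton_mul_span_singleton _ _).symm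

/-- The inclusion of `U_{m,Σ}(O)` in `congruenceElements`. -/
def unitsToCongruenceElements (d : Ideal O) : unitsModPos m S →* congruenceElements d m S where
  toFun u := ⟨((u : Oˣ) : O), u.1.ne_zero, by
    rw [Ideal.span_singleton_eq_top.2 u.1.isUnit, top_sup_eq], u.2.1, u.2.2⟩
  map_one' := rfl
  map_mul' _ _ := rfl

end CongruenceElements

/-! ### The maps of the sequence and their kernels -/

namespace LevelDatum

variable {K : Type*} [Field K] [NumberField K] {D D' : LevelDatum K} (h : Le D D')
  {d : Ideal D'.order}

theorem mem_range_inclusion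
    (hd : idealSet d ⊆ colon (idealSet D.modulus) D'.order) :
    ∀ x ∈ d, x ∈ (Subring.inclusion h.order_le).range := by
  intro x hx
  obtain ⟨y, -, hy⟩ := hd ⟨x, hx, rfl⟩ 1 D'.order.one_mem
  exact ⟨y, Subtype.ext (hy.trans (mul_one _))⟩

theorem comap_le_modulus
    (hd : idealSet d ⊆ colon (idealSet D.modulus) D'.order) :
    d.comap (Subring.inclusion h.order_le) ≤ D.modulus := by
  intro x hx
  obtain ⟨y, hy, hy'⟩ := hd ⟨_, hx, rfl⟩ 1 D'.order.one_mem
  rw [mul_one] at hy'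
  rwa [← Subtype.ext (a1 := y) (a2 := x) hy']

theorem le_modulus (h : Le D D')
    (hd : idealSet d ⊆ colon (idealSet D.modulus) D'.order) : d ≤ D'.modulus := by
  intro x hx
  obtain ⟨y, rfl⟩ := mem_range_inclusion h hd x hx
  exact h.modulus_le (Ideal.mem_map_of_mem _ (comap_le_modulus h hd hx))

theorem comap_ne_bot (hd0 : d ≠ ⊥)
    (hd : idealSet d ⊆ colon (idealSet D.modulus) D'.order) :
    d.comap (Subring.inclusion h.order_le) ≠ ⊥ := by
  obtain ⟨x, hx, hx0⟩ := Submodule.exists_mem_ne_zero_of_ne_bot hd0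
  obtain ⟨y, rfl⟩ := mem_range_inclusion h hd x hx
  intro e
  have hy : y ∈ d.comap (Subring.inclusion h.order_le) := hx
  rw [e, Ideal.mem_bot] at hy
  exact hx0 (by rw [hy, map_zero])

/-- The class of `α` in `U_{m'}(O'/d) / U_m(O/d)`, and its signs. -/
noncomputable def localClass (hdm : d ≤ D'.modulus) :
    congruenceElements d D'.modulus D'.places →*
      LocalIndex h d × (↥(D.places \ D'.places) → ℤˣ) :=
  ((QuotientGroup.mk' _).comp (residue hdm)).prod (signsHom _)

/-- Adding an element of `d` to a representative leaves the residue alone and can produce any signs.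
-/
theorem localClass_surjective (hd0 : d ≠ ⊥) (hdm : d ≤ D'.modulus) :
    Function.Surjective (localClass h hdm) := by
  rintro ⟨x, s⟩
  obtain ⟨v, rfl⟩ := QuotientGroup.mk_surjective x
  obtain ⟨α, hα⟩ := Ideal.Quotient.mk_surjective ((v : (D'.order ⧸ d)ˣ) : D'.order ⧸ d)
  obtain ⟨z, hz, h0, hpos⟩ := exists_mem_forall_pos_iff hd0 α
    fun ρ => ρ ∈ D'.places ∨ ∃ hρ : ρ ∈ D.places \ D'.places, s ⟨ρ, hρ⟩ = 1
  have hv : ((v : (D'.order ⧸ d)ˣ) : D'.order ⧸ d) = Ideal.Quotient.mk d (α + z) := by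
    rw [← hα, map_add, Ideal.Quotient.eq_zero_iff_mem.2 hz, add_zero]
  let β : congruenceElements d D'.modulus D'.places :=
    ⟨α + z, h0, isUnit_mk_iff.1 (hv ▸ v.1.isUnit), (mem_residueUnits_iff hdm hv).1 v.2,
      fun ρ hρ => (hpos ρ).2 (Or.inl hρ)⟩
  refine ⟨β, Prod.ext ?_ ?_⟩
  · have : residue hdm β = v := Subtype.ext (Units.ext hv.symm)
    exact congr_arg QuotientGroup.mk this
  · refine signs_eq_iff.2 fun ρ => (hpos ρ.1).trans ?_
    constructor
    · rintro (hρ | ⟨_, hρ⟩)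
      exacts [absurd hρ ρ.2.2, hρ]
    · exact fun hρ => Or.inr ⟨ρ.2, hρ⟩

theorem localClass_eq_one_iff (hdm : d ≤ D'.modulus)
    (hdm' : d.comap (Subring.inclusion h.order_le) ≤ D.modulus)
    (hd : ∀ x ∈ d, x ∈ (Subring.inclusion h.order_le).range)
    {α : congruenceElements d D'.modulus D'.places} :
    localClass h hdm α = 1 ↔ ∃ w : D.order, Subring.inclusion h.order_le w = α ∧
      Ideal.span {w} ⊔ d.comap (Subring.inclusion h.order_le) = ⊤ ∧ w - 1 ∈ D.modulus ∧
      ∀ ρ ∈ D.places, 0 < ρ (w : K) := by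
  have h1 : localClass h hdm α = 1 ↔
      residue hdm α ∈ (residueMap (Subring.inclusion h.order_le) h.modulus_le d).range ∧
        signs (D.places \ D'.places) ((α : D'.order) : K) = 1 := by
    rw [Prod.ext_iff]
    exact and_congr (QuotientGroup.eq_one_iff _) Iff.rfl
  rw [h1, mem_range_residueMap_iff _ _ hdm', signs_eq_iff, coe_residue]
  constructor
  · rintro ⟨⟨w, hwm, hw, e⟩, hs⟩
    rw [Ideal.Quotient.eq] at e
    obtain ⟨z, hz⟩ := hd _ e
    have hzd : z ∈ d.comap (Subring.inclusion h.order_le) := by rwa [Ideal.mem_comap, hz]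
    -- `α` differs from `w` by an element of `d`, so it lies in `O` itself.
    have hα : Subring.inclusion h.order_le (w + z) = α := by
      rw [map_add, hz, add_sub_cancel]
    refine ⟨w + z, hα, span_sup_eq_top_of_sub_mem hw (by rwa [add_sub_cancel_left]), ?_, ?_⟩
    · rw [add_sub_right_comm]
      exact D.modulus.add_mem hwm (hdm' hzd)
    · intro ρ hρ
      have e' : ((w + z : D.order) : K) = ((α : D'.order) : K) := congr_arg Subtype.val hα
      rw [e']
      by_cases hρ' : ρ ∈ D'.places
      · exact α.2.2.2.2 ρ hρ'
      · exact (hs ⟨ρ, hρ, hρ'⟩).2 rfl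
  · rintro ⟨w, hα, hw, hwm, hpos⟩
    refine ⟨⟨w, hwm, hw, by rw [hα]⟩, fun ρ => iff_of_true ?_ rfl⟩
    rw [← hα]
    exact hpos ρ ρ.2.1

variable (hd0 : d ≠ ⊥) (hd : idealSet d ⊆ colon (idealSet D.modulus) D'.order)

/-- The class of `αO' ∩ O` in `Cl_{m,Σ}(O)`. -/
noncomputable def contractionClass : congruenceElements d D'.modulus D'.places →* D.Cl :=
  (integralClass D.modulus D.places).comp
    ((contraction h.order_le hd0 (mem_range_inclusion h hd) (comap_le_modulus h hd)).comp spanHom)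

theorem contractionClass_eq_one_iff {α : congruenceElements d D'.modulus D'.places} :
    contractionClass h hd0 hd α = 1 ↔ ∃ w : D.order, w ≠ 0 ∧ w - 1 ∈ D.modulus ∧
      (∀ ρ ∈ D.places, 0 < ρ (w : K)) ∧
      (Ideal.span {(α : D'.order)}).comap (Subring.inclusion h.order_le) = Ideal.span {w} :=
  integralClass_eq_one_iff

theorem contractionClass_eq_one_of_localClass_eq_one
    (α : congruenceElements d D'.modulus D'.places)
    (hα : localClass h (le_modulus h hd) α = 1) : contractionClass h hd0 hd α = 1 := by
  obtain ⟨w, hw, hwd, hwm, hpos⟩ := (localClass_eq_one_iff h (le_modulus h hd)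
    (comap_le_modulus h hd) (mem_range_inclusion h hd)).1 hα
  refine (contractionClass_eq_one_iff h hd0 hd).2 ⟨w, ?_, hwm, hpos, ?_⟩
  · rintro rfl
    exact α.2.1 (by rw [← hw, map_zero])
  · rw [← hw, ← Set.image_singleton, ← Ideal.map_span]
    exact comap_map_eq_of_sup_eq_top (Subring.inclusion_injective _) (mem_range_inclusion h hd) hwd

theorem contractionClass_units (u : unitsModPos D'.modulus D'.places) :
    contractionClass h hd0 hd (unitsToCongruenceElements d u) = 1 := by
  refine (contractionClass_eq_one_iff h hd0 hd).2 ⟨1, one_ne_zero, by simp, by simp, ?_⟩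
  have hu : Ideal.span {((unitsToCongruenceElements d u : _) : D'.order)} = ⊤ :=
    Ideal.span_singleton_eq_top.2 u.1.isUnit
  rw [hu, Ideal.comap_top, Ideal.span_singleton_one]

/-- Extending `αO' ∩ O = wO` gives `αO' = wO'`, so `α = wu` with `u` a unit; `u` inherits its
congruence and positivity from `α` and `w`, and `w` has trivial local class. -/
theorem exists_localClass_units_eq {α : congruenceElements d D'.modulus D'.places}
    (hα : contractionClass h hd0 hd α = 1) : ∃ u : unitsModPos D'.modulus D'.places,
      localClass h (le_modulus h hd) (unitsToCongruenceElements d u)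
        = localClass h (le_modulus h hd) α := by
  obtain ⟨w, hw0, hwm, hpos, e⟩ := (contractionClass_eq_one_iff h hd0 hd).1 hα
  have hwd : Ideal.span {w} ⊔ d.comap (Subring.inclusion h.order_le) = ⊤ := by
    rw [← e]
    exact comap_sup_comap_eq_top (mem_range_inclusion h hd) α.2.2.1
  have hwm' : Subring.inclusion h.order_le w - 1 ∈ D'.modulus := by
    have := h.modulus_le (Ideal.mem_map_of_mem (Subring.inclusion h.order_le) hwm)
    rwa [map_sub, map_one] at this
  have e' : Ideal.span {Subring.inclusion h.order_le w} = Ideal.span {(α : D'.order)} := by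
    rw [← map_comap_eq_of_sup_eq_top (mem_range_inclusion h hd) α.2.2.1, e, Ideal.map_span,
      Set.image_singleton]
  obtain ⟨u, hu⟩ := Ideal.span_singleton_eq_span_singleton.1 e'
  let β : congruenceElements d D'.modulus D'.places :=
    ⟨Subring.inclusion h.order_le w, by
      rwa [ne_eq, map_eq_zero_iff _ (Subring.inclusion_injective _)], by
      rw [e']; exact α.2.2.1, hwm', fun ρ hρ => hpos ρ (h.places_le hρ)⟩
  have hu1 : (u : D'.order) - 1 ∈ D'.modulus := by
    have : (u : D'.order) - 1
        = (α - 1 : D'.order) - u * (Subring.inclusion h.order_le w - 1) := by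
      rw [← hu]; ring
    rw [this]
    exact D'.modulus.sub_mem α.2.2.2.1 (D'.modulus.mul_mem_left _ hwm')
  have hu2 : ∀ ρ ∈ D'.places, 0 < ρ ((u : D'.order) : K) := by
    intro ρ hρ
    have h1 : 0 < ρ ((α : D'.order) : K) := α.2.2.2.2 ρ hρ
    rw [← hu, Subring.coe_mul, map_mul] at h1
    exact (pos_iff_pos_of_mul_pos h1).1 (β.2.2.2.2 ρ hρ)
  refine ⟨⟨u, hu1, hu2⟩, ?_⟩
  have h1 : α = β * unitsToCongruenceElements d ⟨u, hu1, hu2⟩ := Subtype.ext hu.symm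
  have h2 : localClass h (le_modulus h hd) β = 1 :=
    (localClass_eq_one_iff h (le_modulus h hd) (comap_le_modulus h hd)
      (mem_range_inclusion h hd)).2 ⟨w, rfl, hwd, hwm, hpos⟩
  rw [h1, map_mul, h2]
  exact (one_mul (M := LocalIndex h d × (↥(D.places \ D'.places) → ℤˣ)) _).symm

/-- A unit of `O'` with trivial local class is some `w ∈ O` coprime to `d`, and `wO = wO' ∩ O = O`
makes it a unit of `O`. -/
theorem localClass_units_eq_one_iff (u : unitsModPos D'.modulus D'.places) :
    localClass h (le_modulus h hd) (unitsToCongruenceElements d u) = 1 ↔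
      u ∈ (unitsInclusion h).range := by
  rw [localClass_eq_one_iff h _ (comap_le_modulus h hd) (mem_range_inclusion h hd)]
  constructor
  · rintro ⟨w, hw, hwd, hwm, hpos⟩
    have hw1 : IsUnit w := by
      rw [← Ideal.span_singleton_eq_top, ← comap_map_eq_of_sup_eq_top
        (Subring.inclusion_injective h.order_le) (mem_range_inclusion h hd) hwd, Ideal.map_span,
        Set.image_singleton, hw]
      have hu : Ideal.span {((unitsToCongruenceElements d u : _) : D'.order)} = ⊤ :=
        Ideal.span_singleton_eq_top.2 u.1.isUnit
      rw [hu, Ideal.comap_top]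
    obtain ⟨w, rfl⟩ := hw1
    exact ⟨⟨w, hwm, hpos⟩, Subtype.ext (Units.ext hw)⟩
  · rintro ⟨w, rfl⟩
    refine ⟨((w : D.orderˣ) : D.order), rfl, ?_, w.2.1, w.2.2⟩
    rw [Ideal.span_singleton_eq_top.2 w.1.isUnit, top_sup_eq]

/-- The map `u ↦ (u mod d, sgn u)` on `U_{m',Σ'}(O') / U_{m,Σ}(O)`. -/
noncomputable def unitIndexMap :
    UnitIndex h →* LocalIndex h d × (↥(D.places \ D'.places) → ℤˣ) :=
  quotientLift (unitsInclusion h).range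
    ((localClass h (le_modulus h hd)).comp (unitsToCongruenceElements d))
    fun u hu => (localClass_units_eq_one_iff h hd u).2 hu

/-- The extension map `Cl_{m,Σ}(O) → Cl_{m',Σ'}(O')`. -/
noncomputable def clMap : D.Cl →* D'.Cl :=
  extensionClass h.order_le h.modulus_le h.places_le

theorem clMap_contractionClass (α : congruenceElements d D'.modulus D'.places) :
    clMap h (contractionClass h hd0 hd α) = 1 := by
  refine (extensionClass_integralClass _ _ _ _).trans (integralClass_eq_one_iff.2
    ⟨α, α.2.1, α.2.2.2.1, α.2.2.2.2, ?_⟩)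
  exact map_comap_eq_of_sup_eq_top (mem_range_inclusion h hd) α.2.2.1

/-- Represent `c` by an ideal `a` coprime to `d`. Its extension is some `γO'`, and contracting
recovers `a = γO' ∩ O`. -/
theorem exists_contractionClass_eq {c : D.Cl} (hc : clMap h c = 1) :
    ∃ α, contractionClass h hd0 hd α = c := by
  have := D.isOrder.hasFiniteQuotients
  obtain ⟨a, had, rfl⟩ := exists_integralClass_eq (comap_ne_bot h hd0 hd) (comap_le_modulus h hd)
    D.places c
  obtain ⟨γ, hγ0, hγm, hpos, e⟩ := integralClass_eq_one_iff.1
    ((extensionClass_integralClass h.order_le h.modulus_le h.places_le a).symm.trans hc)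
  change (a : Ideal D.order).map _ = _ at e
  refine ⟨⟨γ, hγ0, ?_, hγm, hpos⟩, congr_arg (integralClass _ _) (Subtype.ext ?_)⟩
  · rw [← e]
    exact map_sup_eq_top _ had Ideal.map_comap_le
  · change (Ideal.span {γ}).comap _ = _
    rw [← e]
    exact comap_map_eq_of_sup_eq_top (Subring.inclusion_injective _) (mem_range_inclusion h hd) had

theorem clMap_surjective (hd0 : d ≠ ⊥)
    (hd : idealSet d ⊆ colon (idealSet D.modulus) D'.order) : Function.Surjective (clMap h) := by
  intro c
  have := D'.isOrder.hasFiniteQuotients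
  obtain ⟨A, hA, rfl⟩ := exists_integralClass_eq hd0 (le_modulus h hd) D'.places c
  refine ⟨integralClass _ _ (contraction h.order_le hd0 (mem_range_inclusion h hd)
    (comap_le_modulus h hd) ⟨A, A.2.1, hA⟩), (extensionClass_integralClass _ _ _ _).trans
    (congr_arg (integralClass _ _) (Subtype.ext ?_))⟩
  exact map_comap_eq_of_sup_eq_top (mem_range_inclusion h hd) hA

end LevelDatum

end RayClass

/-! ### The exact sequence -/

open RayClass LevelDatum

theorem theorem5p2 {K : Type*} [Field K] [NumberField K]
    (D D' : RayClass.LevelDatum K) (h : RayClass.LevelDatum.Le D D')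
    (d : Ideal D'.order) (hd0 : d ≠ ⊥)
    (hd : RayClass.idealSet d ⊆ RayClass.colon (RayClass.idealSet D.modulus) D'.order) :
    ∃ (f : RayClass.LevelDatum.UnitIndex h →*
          RayClass.LevelDatum.LocalIndex h d × (↥(D.places \ D'.places) → ℤˣ))
      (g : RayClass.LevelDatum.LocalIndex h d × (↥(D.places \ D'.places) → ℤˣ) →* D.Cl)
      (e : D.Cl →* D'.Cl),
      -- `f` sends the class of `u` to the class of `u mod d` and the signs of `u`
      (∀ u : RayClass.unitsModPos D'.modulus D'.places, ∃ v : RayClass.residueUnits D'.modulus d,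
        ((v : (D'.order ⧸ d)ˣ) : D'.order ⧸ d)
          = Ideal.Quotient.mk d ((u : D'.orderˣ) : D'.order) ∧
        f (QuotientGroup.mk u) = (QuotientGroup.mk v,
          RayClass.signs (D.places \ D'.places) (((u : D'.orderˣ) : D'.order) : K))) ∧
      -- `g` sends the class of `α mod d` and the signs of `α` to the class of `αO' ∩ O`
      (∀ (α : D'.order) (v : RayClass.residueUnits D'.modulus d), α ≠ 0 →
        ((v : (D'.order ⧸ d)ˣ) : D'.order ⧸ d) = Ideal.Quotient.mk d α →
        (∀ ρ ∈ D'.places, 0 < ρ (α : K)) →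
        ∃ c : RayClass.coprimeIdeals (K := K) D.modulus,
          (((c : (FractionalIdeal (nonZeroDivisors D.order) K)ˣ) :
              FractionalIdeal (nonZeroDivisors D.order) K) : Set K)
            = RayClass.idealSet (Ideal.span {α}) ∩ D.order ∧
          g (QuotientGroup.mk v, RayClass.signs (D.places \ D'.places) (α : K))
            = QuotientGroup.mk c) ∧
      -- `e` sends the class of `a` to the class of `aO'`
      (∀ a : RayClass.coprimeIdeals (K := K) D.modulus,
        ∃ b : RayClass.coprimeIdeals (K := K) D'.modulus,
          (((b : (FractionalIdeal (nonZeroDivisors D'.order) K)ˣ) :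
              FractionalIdeal (nonZeroDivisors D'.order) K) : Set K)
            = Submodule.span D'.order
              (((a : (FractionalIdeal (nonZeroDivisors D.order) K)ˣ) :
                FractionalIdeal (nonZeroDivisors D.order) K) : Set K) ∧
          e (QuotientGroup.mk a) = QuotientGroup.mk b) ∧
      Function.Injective f ∧ Function.MulExact f g ∧ Function.MulExact g e ∧
      Function.Surjective e := by
  -- `g` is known only through its values on local classes; surjectivity of `localClass` turns each
  -- exactness claim into one about elements `α`.
  obtain ⟨g, hg⟩ := exists_comp_eq_of_surjective (φ := localClass h (le_modulus h hd))
    (ψ := contractionClass h hd0 hd) (fun a => ⟨a⁻¹, mul_inv_cancel a⟩)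
    (localClass_surjective h hd0 (le_modulus h hd))
    (contractionClass_eq_one_of_localClass_eq_one h hd0 hd)
  have hsurj := localClass_surjective h hd0 (le_modulus h hd)
  refine ⟨unitIndexMap h hd, g,
    clMap h, fun u => ⟨residue (le_modulus h hd) (unitsToCongruenceElements d u), rfl, rfl⟩,
    fun α v h0 hv hpos => ?_, fun a => ⟨extensionCoprime h.order_le h.modulus_le a,
      coe_extension h.order_le _, rfl⟩, ?_, fun y => ?_, fun c => ?_, clMap_surjective h hd0 hd⟩
  · let β : congruenceElements d D'.modulus D'.places :=
      ⟨α, h0, isUnit_mk_iff.1 (hv ▸ v.1.isUnit), (mem_residueUnits_iff (le_modulus h hd) hv).1 v.2,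
        hpos⟩
    refine ⟨toCoprimeIdeals _ (contraction h.order_le hd0 (mem_range_inclusion h hd)
      (comap_le_modulus h hd) (spanHom β)), ?_, ?_⟩
    · ext x
      rw [coe_toCoprimeIdeals, SetLike.mem_coe, FractionalIdeal.mem_coeIdeal]
      constructor
      · rintro ⟨y, hy, rfl⟩
        exact ⟨⟨_, hy, rfl⟩, y.2⟩
      · rintro ⟨⟨z, hz, rfl⟩, hx⟩
        exact ⟨⟨z, hx⟩, hz, rfl⟩
    · have hβ : residue (le_modulus h hd) β = v := Subtype.ext (Units.ext hv.symm)
      rw [← hβ]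
      exact hg β
  · rw [injective_iff_map_eq_one]
    intro x hx
    obtain ⟨u, rfl⟩ := QuotientGroup.mk_surjective x
    exact (QuotientGroup.eq_one_iff u).2 ((localClass_units_eq_one_iff h hd u).1 hx)
  · obtain ⟨α, rfl⟩ := hsurj y
    rw [hg]
    constructor
    · intro hα
      obtain ⟨u, hu⟩ := exists_localClass_units_eq h hd0 hd hα
      exact ⟨QuotientGroup.mk u, hu⟩
    · rintro ⟨x, hx⟩
      obtain ⟨u, rfl⟩ := QuotientGroup.mk_surjective x
      rw [← hg, ← hx]
      exact (hg (unitsToCongruenceElements d u)).trans (contractionClass_units h hd0 hd u)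
  · constructor
    · intro hc
      obtain ⟨α, rfl⟩ := exists_contractionClass_eq h hd0 hd hc
      exact ⟨_, hg α⟩
    · rintro ⟨y, rfl⟩
      obtain ⟨α, rfl⟩ := hsurj y
      rw [hg, clMap_contractionClass]
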